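/- For a real number $x$ let $\|x\|=\min_{n\in\mathbb Z}|x-n|$, let $\mathbf e(x)=e^{2\pi i x}$, and let $\Lambda$ be the von Mangoldt function. The type of an irrational number $\gamma$ is $$\tau=\sup\Bigl\{\varrho\in\mathbb R:\ \liminf_{n\to\infty,\ n\in\mathbb N} n^{\varrho}\,\|\gamma n\|=0\Bigr\}\in[1,\infty].$$ Let $\gamma$ be an irrational number of finite type $\tau<\infty$. Then, for every real number $\varepsilon$ with $0<\varepsilon<1/(8\tau)$, there are numbers $\eta>0$ and $M_0$ (depending only on $\gamma$ and $\varepsilon$) such that for all real $M\ge M_0$ the bound $$\Bigl|\sum_{1\le m\le M}\Lambda(qm+a)\,\mathbf e(\gamma k m)\Bigr|\le M^{1-\eta}$$ holds for all integers $k$ with $1\le k\le M^{\varepsilon}$ and all integers $a,q$ with $0\le a<q\le M^{\varepsilon/4}$ and $\gcd(a,q)=1$. -/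

import Mathlib

/-- The distance `‖x‖ = min_{n ∈ ℤ} |x - n|` from a real number `x` to the nearest integer. -/
noncomputable def distNearestInt (x : ℝ) : ℝ := |x - round x|

/-- `distNearestInt x` is indeed the minimum of `|x - n|` over all integers `n`. -/
theorem distNearestInt_isLeast (x : ℝ) :
    IsLeast (Set.range fun n : ℤ => |x - n|) (distNearestInt x) :=
  ⟨⟨round x, rfl⟩, by
    rintro _ ⟨n, rfl⟩
    exact round_le x n⟩

/-- The type of `γ`: the supremum of all real `ρ` with `liminf_{n → ∞} n ^ ρ * ‖γ n‖ = 0`.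
The limit inferior is taken in `[0, ∞]` and the supremum in `[-∞, ∞]`, since both may be
infinite. The number `γ` is of finite type if the supremum is a real number. -/
noncomputable def diophantineType (γ : ℝ) : EReal :=
  sSup ((fun ρ : ℝ => (ρ : EReal)) ''
    {ρ : ℝ | Filter.liminf
      (fun n : ℕ => ENNReal.ofReal ((n : ℝ) ^ ρ * distNearestInt (γ * n))) Filter.atTop = 0})

/-- The additive character `e(x) = exp(2 π i x)`. -/
noncomputable def addChar (x : ℝ) : ℂ := Complex.exp (2 * Real.pi * Complex.I * x)

/-!
The sum over the progression is the average over `b` modulo `q`, up to unimodular factors, of the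
sums `∑ Λ(n) e(α n)` over all `n ≤ N ≈ q M` at the frequencies `α = (γ k + b) / q`
(`mul_sum_progression_eq`); the single term `m = 0` accounts for an error `log q`. So it suffices to
bound each of these sums by `M ^ (1 - η')`. Note that `N` may exceed `M` by a factor `M ^ (ε / 4)`,
which the saving has to absorb.

By Dirichlet's theorem `α` is within `1 / r²` of a reduced fraction with denominator
`r ≤ M ^ (4 / 9)`. If `r` were small, then `‖γ k r‖` would be at most about `q M ^ (-4 / 9)` with
`k r` small, against the finite type of `γ`: for every `ρ > τ` one has `‖γ n‖ ≥ c n ^ (-ρ)`. This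
gives `r ≥ c' M ^ β` with `β = (4 / 9 - ε / 4) / ρ - ε`, and the hypothesis `8 ε τ < 1` together
with `τ ≥ 1` (`one_le_diophantineType`) gives `β > ε` for `ρ = 3 τ / 2`.

What remains is an estimate of Vinogradov's kind,
`∑_{n ≤ N} Λ(n) e(α n) ≪ N ^ δ (r² + N r ^ (-1 / 4))` (`exists_norm_expSum_vonMangoldt_le_rpow`);
the saving `r ^ (1 / 4) ≥ M ^ (β / 4)` beats the loss `M ^ (ε / 4)` exactly because `β > ε`.
It follows from Vaughan's identity (`ArithmeticFunction.vonMangoldt_eq_vaughan`) with both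
parameters equal to `s = ⌊√(r / 2)⌋`. This choice is not the optimal one, but it makes the linear
sums trivial: their outer variable `d` is at most `s² ≤ r / 2`, so that `‖α d‖ ≥ 1 / (2r)` and each
inner geometric sum is `O(r)` (`norm_expSum_mul_le_of_support`). The bilinear sum is cut into dyadic
blocks; Cauchy–Schwarz leads to sums of `min (L, 1 / ‖α h‖)`, which the spacing of the points `α h`
modulo one controls (`sum_range_le_of_distNearestInt`, `norm_bilinear_block_sq_le`). Both of its
variables exceed `s ≈ √r`, and so a square root of `√r` is saved.
-/

/-! ### Exponential sums over arithmetic progressions -/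

theorem addChar_add (x y : ℝ) : addChar (x + y) = addChar x * addChar y := by
  simp only [addChar, ← Complex.exp_add]
  push_cast
  ring_nf

theorem addChar_zero : addChar 0 = 1 := by simp [addChar]

theorem addChar_intCast (n : ℤ) : addChar n = 1 := by
  rw [addChar, Complex.exp_eq_one_iff]
  exact ⟨n, by push_cast; ring⟩

theorem addChar_eq_exp_I_mul (x : ℝ) :
    addChar x = Complex.exp (Complex.I * ((2 * Real.pi * x : ℝ) : ℂ)) := by
  rw [addChar]
  push_cast
  ring_nf

theorem norm_addChar (x : ℝ) : ‖addChar x‖ = 1 := by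
  rw [addChar_eq_exp_I_mul, mul_comm, Complex.norm_exp_ofReal_mul_I]

theorem addChar_neg (x : ℝ) : addChar (-x) = (starRingEnd ℂ) (addChar x) := by
  rw [addChar_eq_exp_I_mul, addChar_eq_exp_I_mul, ← Complex.exp_conj, map_mul, Complex.conj_I,
    Complex.conj_ofReal]
  push_cast
  ring_nf

theorem addChar_mul_natCast (x : ℝ) (n : ℕ) : addChar (x * n) = addChar x ^ n := by
  rw [addChar, addChar, ← Complex.exp_nat_mul]
  push_cast
  ring_nf

theorem distNearestInt_nonneg (x : ℝ) : 0 ≤ distNearestInt x := abs_nonneg _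

theorem distNearestInt_le_abs_sub (x : ℝ) (n : ℤ) : distNearestInt x ≤ |x - n| :=
  round_le x n

theorem four_mul_distNearestInt_le (x : ℝ) : 4 * distNearestInt x ≤ ‖addChar x - 1‖ := by
  set y : ℝ := x - round x with hy
  have hxy : addChar x = addChar y := by
    have : x = y + (round x : ℤ) := by rw [hy]; ring
    conv_lhs => rw [this]
    rw [addChar_add, addChar_intCast, mul_one]
  have habs : |y| ≤ 1 / 2 := abs_sub_round x
  rw [hxy, addChar_eq_exp_I_mul, Complex.norm_exp_I_mul_ofReal_sub_one, Real.norm_eq_abs, abs_mul,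
    abs_two, show 2 * Real.pi * y / 2 = Real.pi * y by ring]
  have hpi : |Real.pi * y| ≤ Real.pi / 2 := by
    rw [abs_mul, abs_of_pos Real.pi_pos]
    nlinarith [Real.pi_pos]
  have h := Real.mul_abs_le_abs_sin hpi
  rw [abs_mul, abs_of_pos Real.pi_pos, ← mul_assoc, div_mul_cancel₀ _ Real.pi_ne_zero] at h
  change 4 * |y| ≤ _
  linarith

theorem norm_sum_range_addChar_mul_le (x : ℝ) (n : ℕ) :
    ‖∑ i ∈ Finset.range n, addChar (x * i)‖ * distNearestInt x ≤ 1 / 2 := by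
  have h1 : (∑ i ∈ Finset.range n, addChar (x * i)) * (addChar x - 1) = addChar x ^ n - 1 := by
    simp_rw [addChar_mul_natCast]
    exact geom_sum_mul _ n
  have h2 : ‖∑ i ∈ Finset.range n, addChar (x * i)‖ * ‖addChar x - 1‖ ≤ 2 := by
    rw [← norm_mul, h1]
    refine (norm_sub_le _ _).trans ?_
    rw [norm_pow, norm_addChar]
    norm_num
  have h3 := mul_le_mul_of_nonneg_left (four_mul_distNearestInt_le x)
    (norm_nonneg (∑ i ∈ Finset.range n, addChar (x * i)))
  linarith

theorem norm_sum_Ico_addChar_mul_le (x : ℝ) (m n : ℕ) :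
    ‖∑ i ∈ Finset.Ico m n, addChar (x * i)‖ * distNearestInt x ≤ 1 / 2 := by
  have h : ∑ i ∈ Finset.Ico m n, addChar (x * i)
      = addChar (x * m) * ∑ i ∈ Finset.range (n - m), addChar (x * i) := by
    rw [Finset.sum_Ico_eq_sum_range, Finset.mul_sum]
    refine Finset.sum_congr rfl fun i _ => ?_
    rw [← addChar_add]
    push_cast
    ring_nf
  rw [h, norm_mul, norm_addChar, one_mul]
  exact norm_sum_range_addChar_mul_le x _

/-! ### Spacing of the multiples of a well approximable number -/

/-- If `α` is within `1 / r²` of a reduced fraction with denominator `r`, then the multiples of `α`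
by nonzero integers of size at most `r / 2` stay away from the integers: they are within `1 / (2r)`
of a fraction with denominator `r` that is not an integer. -/
theorem one_div_two_mul_le_distNearestInt {α : ℝ} {c : ℤ} {r : ℕ} (hr : 0 < r)
    (hcr : IsCoprime c (r : ℤ)) (hα : |α - c / r| ≤ 1 / (r : ℝ) ^ 2) {h : ℤ} (h0 : h ≠ 0)
    (hh : 2 * |h| ≤ r) : 1 / (2 * r : ℝ) ≤ distNearestInt (α * h) := by
  have hr' : (0 : ℝ) < r := by exact_mod_cast hr
  set z : ℤ := round (α * h) with hz
  have hne : c * h - z * r ≠ 0 := by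
    intro h1
    have hd : (r : ℤ) ∣ c * h := ⟨z, by linarith⟩
    have hd2 : (r : ℤ) ∣ h := hcr.symm.dvd_of_dvd_mul_left hd
    have := Int.le_of_dvd (abs_pos.2 h0) ((dvd_abs _ _).2 hd2)
    have := abs_pos.2 h0
    omega
  have h1 : (1 : ℝ) ≤ |(c * h - z * r : ℝ)| := by
    have := Int.one_le_abs hne
    exact_mod_cast this
  have h2 : |(α - c / r) * h| ≤ 1 / (2 * r) := by
    have hhr : |(h : ℝ)| ≤ r / 2 := by
      have : (2 * |(h : ℝ)|) ≤ r := by exact_mod_cast hh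
      linarith
    rw [abs_mul]
    calc |α - c / r| * |(h : ℝ)| ≤ 1 / (r : ℝ) ^ 2 * (r / 2) := by gcongr
      _ = 1 / (2 * r) := by field_simp
  have h3 : (c * h - z * r : ℝ) / r = (α * h - z) - (α - c / r) * h := by field_simp; ring
  have h4 : 1 / (r : ℝ) ≤ |(c * h - z * r : ℝ) / r| := by
    rw [abs_div, abs_of_pos hr']
    gcongr
  rw [h3] at h4
  have h5 := abs_sub (α * h - z) ((α - c / r) * h)
  have h6 : 1 / (r : ℝ) = 1 / (2 * r) + 1 / (2 * r) := by field_simp; norm_num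
  change _ ≤ |α * h - z|
  linarith

/-- The `n`-th of the bins of width `1 / (2r)` into which `y` falls holds at most one point, and a
point of the `n`-th bin contributes at most `r / n`. -/
theorem sum_le_of_separated {ι : Type*} (s : Finset ι) (r : ℕ) (hr : 0 < r) (L : ℝ) (hL : 0 ≤ L)
    (y t : ι → ℝ) (hy0 : ∀ i ∈ s, 0 ≤ y i) (hy1 : ∀ i ∈ s, y i ≤ 1 / 2)
    (hsep : ∀ i ∈ s, ∀ j ∈ s, i ≠ j → 1 / (2 * r : ℝ) ≤ |y i - y j|)
    (ht : ∀ i ∈ s, t i ≤ L) (hty : ∀ i ∈ s, t i * y i ≤ 1 / 2) :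
    ∑ i ∈ s, t i ≤ L + r * (1 + Real.log r) := by
  classical
  have hr' : (0 : ℝ) < r := by exact_mod_cast hr
  set b : ι → ℕ := fun i => ⌊2 * r * y i⌋₊ with hb
  set G : ℕ → ℝ := fun n => if n = 0 then L else r / n with hG
  have hinj : Set.InjOn b s := by
    intro i hi j hj hij
    by_contra hne
    have h1 := hsep i hi j hj hne
    have hi1 := Nat.floor_le (a := 2 * r * y i) (by have := hy0 i hi; positivity)
    have hj1 := Nat.floor_le (a := 2 * r * y j) (by have := hy0 j hj; positivity)
    have hi2 := Nat.lt_floor_add_one (2 * r * y i)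
    have hj2 := Nat.lt_floor_add_one (2 * r * y j)
    have hij' : (⌊2 * r * y i⌋₊ : ℝ) = ⌊2 * r * y j⌋₊ := congrArg Nat.cast hij
    have h2 : |2 * r * y i - 2 * r * y j| < 1 := by
      rw [abs_lt]
      constructor <;> linarith
    rw [← mul_sub, abs_mul, abs_of_pos (by positivity : (0 : ℝ) < 2 * r)] at h2
    have h3 : 2 * r * (1 / (2 * r : ℝ)) ≤ 2 * r * |y i - y j| := by gcongr
    rw [mul_one_div_cancel (by positivity)] at h3
    linarith
  have hle : ∀ i ∈ s, t i ≤ G (b i) := by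
    intro i hi
    simp only [hG]
    split_ifs with h0
    · exact ht i hi
    · have hb1 : (0 : ℝ) < b i := by exact_mod_cast Nat.pos_of_ne_zero h0
      have hfl := Nat.floor_le (a := 2 * r * y i) (by have := hy0 i hi; positivity)
      change (b i : ℝ) ≤ _ at hfl
      have h3 := hty i hi
      rw [le_div_iff₀ hb1]
      rcases le_or_gt (t i) 0 with hneg | hpos
      · nlinarith
      · calc t i * b i ≤ t i * (2 * r * y i) := by gcongr
          _ = 2 * r * (t i * y i) := by ring
          _ ≤ 2 * r * (1 / 2) := by gcongr
          _ = r := by ring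
  have hGnn : ∀ n, 0 ≤ G n := by
    intro n
    simp only [hG]
    split_ifs <;> positivity
  have hsub : s.image b ⊆ Finset.range (r + 1) := by
    intro n hn
    obtain ⟨i, hi, rfl⟩ := Finset.mem_image.1 hn
    rw [Finset.mem_range, Nat.lt_succ_iff]
    refine Nat.floor_le_of_le ?_
    have := hy1 i hi
    nlinarith
  calc ∑ i ∈ s, t i ≤ ∑ i ∈ s, G (b i) := Finset.sum_le_sum hle
    _ = ∑ n ∈ s.image b, G n := (Finset.sum_image hinj).symm
    _ ≤ ∑ n ∈ Finset.range (r + 1), G n :=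
        Finset.sum_le_sum_of_subset_of_nonneg hsub fun n _ _ => hGnn n
    _ = L + r * (harmonic r : ℚ) := by
        rw [Finset.sum_range_succ', add_comm]
        simp only [hG, if_pos, harmonic, Nat.succ_ne_zero, if_false]
        push_cast
        rw [Finset.mul_sum]
        simp [div_eq_mul_inv]
    _ ≤ L + r * (1 + Real.log r) := by
        gcongr
        exact harmonic_le_one_add_log r

/-- A sum of terms bounded by `min L (1 / (2‖x‖))` over points `x` that are `1 / (2r)`-separated
modulo one. -/
theorem sum_le_of_separated_distNearestInt {ι : Type*} (s : Finset ι) (r : ℕ) (hr : 0 < r) (L : ℝ)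
    (hL : 0 ≤ L) (x t : ι → ℝ)
    (hsep : ∀ i ∈ s, ∀ j ∈ s, i ≠ j → 1 / (2 * r : ℝ) ≤ distNearestInt (x i - x j))
    (ht : ∀ i ∈ s, t i ≤ L) (htx : ∀ i ∈ s, t i * distNearestInt (x i) ≤ 1 / 2) :
    ∑ i ∈ s, t i ≤ 2 * (L + r * (1 + Real.log r)) := by
  classical
  set y : ι → ℝ := fun i => x i - round (x i) with hy
  have habs : ∀ i, |y i| ≤ 1 / 2 := fun i => abs_sub_round _
  have hsep' : ∀ i ∈ s, ∀ j ∈ s, i ≠ j → 1 / (2 * r : ℝ) ≤ |y i - y j| := by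
    intro i hi j hj hij
    refine (hsep i hi j hj hij).trans ?_
    have := distNearestInt_le_abs_sub (x i - x j) (round (x i) - round (x j))
    refine this.trans (le_of_eq ?_)
    simp only [hy]
    push_cast
    ring_nf
  rw [← Finset.sum_filter_add_sum_filter_not s (fun i => 0 ≤ y i), two_mul]
  refine add_le_add ?_ ?_
  · refine sum_le_of_separated _ r hr L hL y t ?_ ?_ ?_ ?_ ?_
    · intro i hi; exact (Finset.mem_filter.1 hi).2
    · intro i _; exact (le_abs_self _).trans (habs i)
    · intro i hi j hj; exact hsep' i (Finset.mem_filter.1 hi).1 j (Finset.mem_filter.1 hj).1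
    · intro i hi; exact ht i (Finset.mem_filter.1 hi).1
    · intro i hi
      obtain ⟨h1, h2⟩ := Finset.mem_filter.1 hi
      have := htx i h1
      rwa [distNearestInt, abs_of_nonneg (show 0 ≤ x i - round (x i) from h2)] at this
  · refine sum_le_of_separated _ r hr L hL (fun i => -y i) t ?_ ?_ ?_ ?_ ?_
    · intro i hi
      have := (Finset.mem_filter.1 hi).2
      linarith
    · intro i _; exact (neg_le_abs _).trans (habs i)
    · intro i hi j hj hij
      have := hsep' i (Finset.mem_filter.1 hi).1 j (Finset.mem_filter.1 hj).1 hij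
      rwa [← abs_neg, show -(-y i - -y j) = y i - y j by ring]
    · intro i hi; exact ht i (Finset.mem_filter.1 hi).1
    · intro i hi
      obtain ⟨h1, h2⟩ := Finset.mem_filter.1 hi
      have := htx i h1
      rwa [distNearestInt, abs_of_neg (show x i - round (x i) < 0 from not_le.1 h2)] at this

/-- The interval of summation is cut into blocks of length `⌊r / 2⌋`, on each of which the points
`α n + β` are separated modulo one. -/
theorem sum_range_le_of_distNearestInt {α : ℝ} {c : ℤ} {r : ℕ} (hr : 2 ≤ r)
    (hcr : IsCoprime c (r : ℤ)) (hα : |α - c / r| ≤ 1 / (r : ℝ) ^ 2) (β L : ℝ) (hL : 0 ≤ L)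
    (t : ℕ → ℝ) (T : ℕ) (ht0 : ∀ n, 0 ≤ t n) (ht : ∀ n, t n ≤ L)
    (htx : ∀ n, t n * distNearestInt (α * n + β) ≤ 1 / 2) :
    ∑ n ∈ Finset.range T, t n ≤ (4 * T / r + 1) * (2 * (L + r * (1 + Real.log r))) := by
  set B : ℕ := r / 2 with hB
  have hB1 : 1 ≤ B := by omega
  have hr' : (0 : ℝ) < r := by positivity
  have hblock : ∀ j : ℕ, ∑ i ∈ Finset.range B, t (B * j + i) ≤ 2 * (L + r * (1 + Real.log r)) := by
    intro j
    refine sum_le_of_separated_distNearestInt (Finset.range B) r (by omega) L hL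
      (fun i => α * ((B * j + i : ℕ) : ℝ) + β) _ ?_ (fun i _ => ht _) (fun i _ => htx _)
    intro i hi k hk hik
    rw [Finset.mem_range] at hi hk
    have h := one_div_two_mul_le_distNearestInt (by omega) hcr hα (h := (i : ℤ) - k)
      (by omega) (by rcases abs_cases ((i : ℤ) - k) with h | h <;> omega)
    convert h using 2
    push_cast
    ring
  have hmul : ∀ J : ℕ, ∑ n ∈ Finset.range (B * J), t n
      = ∑ j ∈ Finset.range J, ∑ i ∈ Finset.range B, t (B * j + i) := by
    intro J
    induction J with
    | zero => simp
    | succ J ih => rw [Nat.mul_succ, Finset.sum_range_add, ih, Finset.sum_range_succ]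
  have hpos : 0 ≤ 2 * (L + r * (1 + Real.log r)) := by
    have : 0 ≤ Real.log r := Real.log_natCast_nonneg r
    positivity
  have hTJ : T ≤ B * (T / B + 1) := (Nat.lt_mul_div_succ T (by omega)).le
  calc ∑ n ∈ Finset.range T, t n ≤ ∑ n ∈ Finset.range (B * (T / B + 1)), t n :=
        Finset.sum_le_sum_of_subset_of_nonneg (Finset.range_mono hTJ) fun n _ _ => ht0 n
    _ ≤ ∑ j ∈ Finset.range (T / B + 1), 2 * (L + r * (1 + Real.log r)) := by
        rw [hmul]
        exact Finset.sum_le_sum fun j _ => hblock j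
    _ = ((T / B : ℕ) + 1 : ℝ) * (2 * (L + r * (1 + Real.log r))) := by simp
    _ ≤ (4 * T / r + 1) * (2 * (L + r * (1 + Real.log r))) := by
        refine mul_le_mul_of_nonneg_right ?_ hpos
        have h1 : ((T / B : ℕ) : ℝ) ≤ T / B := Nat.cast_div_le
        have hBr : (r : ℝ) ≤ 4 * B := by
          have : r ≤ 4 * B := by omega
          exact_mod_cast this
        have hB0 : (0 : ℝ) < B := by exact_mod_cast hB1
        have h2 : (T : ℝ) / B ≤ 4 * T / r := by
          rw [div_le_div_iff₀ hB0 hr']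
          nlinarith [Nat.cast_nonneg (α := ℝ) T]
        linarith

/-! ### Bilinear sums -/

theorem sum_Ioc_zero_eq_sum_range {M : Type*} [AddCommMonoid M] (f : ℕ → M) (n : ℕ) :
    ∑ m ∈ Finset.Ioc 0 n, f m = ∑ m ∈ Finset.range n, f (m + 1) := by
  rw [Finset.range_eq_Ico, Finset.sum_Ico_add' f 0 n 1]
  rfl

/-- After the square is opened, the coefficients are discarded and the inner sum over `l` runs over
an interval, for which the bounds for geometric sums are available. -/
theorem sum_norm_sq_range_div_le (α : ℝ) (N L : ℕ) (hL : 0 < L) (a : ℕ → ℂ) (A : ℝ)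
    (hA : ∀ m, m < N / L → ‖a m‖ ≤ A) :
    ∑ l ∈ Finset.Ico L (2 * L),
        ‖∑ m ∈ Finset.range (N / l), a m * addChar (α * (l * (m + 1 : ℕ)))‖ ^ 2 ≤
      ∑ m₂ ∈ Finset.range (N / L), ∑ m₁ ∈ Finset.range (N / L), A ^ 2 *
        ‖∑ l ∈ Finset.Ico L (min (2 * L) (N / (max (m₁ + 1) (m₂ + 1)) + 1)),
          addChar ((α * m₁ + -(α * m₂)) * l)‖ := by
  set T := N / L with hT
  have hrange : ∀ l ∈ Finset.Ico L (2 * L), ∀ f : ℕ → ℂ,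
      ∑ m ∈ Finset.range (N / l), f m
        = ∑ m ∈ Finset.range T, if l * (m + 1) ≤ N then f m else 0 := by
    intro l hl f
    rw [Finset.mem_Ico] at hl
    rw [← Finset.sum_filter]
    refine Finset.sum_congr ?_ fun _ _ => rfl
    ext m
    have hl0 : 0 < l := by omega
    have h1 : m < N / l ↔ l * (m + 1) ≤ N := by
      rw [← Nat.succ_le_iff, Nat.le_div_iff_mul_le hl0, mul_comm]
    have h2 : N / l ≤ T := Nat.div_le_div_left hl.1 hL
    simp only [Finset.mem_range, Finset.mem_filter, h1]
    constructor
    · intro h; exact ⟨lt_of_lt_of_le (h1.2 h) h2, h⟩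
    · exact fun h => h.2
  have hsq : ∀ l ∈ Finset.Ico L (2 * L),
      ((‖∑ m ∈ Finset.range (N / l), a m * addChar (α * (l * (m + 1 : ℕ)))‖ ^ 2 : ℝ) : ℂ)
        = ∑ m₂ ∈ Finset.range T, ∑ m₁ ∈ Finset.range T,
            a m₁ * (starRingEnd ℂ) (a m₂) *
              (if l * (m₁ + 1) ≤ N ∧ l * (m₂ + 1) ≤ N then
                addChar ((α * m₁ + -(α * m₂)) * l) else 0) := by
    intro l hl
    rw [hrange l hl]
    push_cast
    rw [← Complex.mul_conj', map_sum, Finset.mul_sum]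
    refine Finset.sum_congr rfl fun m₂ _ => ?_
    rw [Finset.sum_mul]
    refine Finset.sum_congr rfl fun m₁ _ => ?_
    have he : addChar ((α * m₁ + -(α * m₂)) * l)
        = addChar (α * (l * (m₁ + 1 : ℕ))) * (starRingEnd ℂ) (addChar (α * (l * (m₂ + 1 : ℕ)))) := by
      rw [← addChar_neg, ← addChar_add]
      congr 1
      push_cast
      ring
    rw [he]
    by_cases h1 : l * (m₁ + 1) ≤ N <;> by_cases h2 : l * (m₂ + 1) ≤ N <;>
      simp [h1, h2]
    ring
  have hint : ∀ m₁ m₂ : ℕ, ∀ f : ℕ → ℂ,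
      ∑ l ∈ Finset.Ico L (2 * L), (if l * (m₁ + 1) ≤ N ∧ l * (m₂ + 1) ≤ N then f l else 0)
        = ∑ l ∈ Finset.Ico L (min (2 * L) (N / (max (m₁ + 1) (m₂ + 1)) + 1)), f l := by
    intro m₁ m₂ f
    rw [← Finset.sum_filter]
    refine Finset.sum_congr ?_ fun _ _ => rfl
    ext l
    have h1 : l < N / (max (m₁ + 1) (m₂ + 1)) + 1 ↔ l * (m₁ + 1) ≤ N ∧ l * (m₂ + 1) ≤ N := by
      rw [Nat.lt_succ_iff, Nat.le_div_iff_mul_le (by positivity), ← Nat.mul_max_mul_left, max_le_iff]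
    simp only [Finset.mem_filter, Finset.mem_Ico, lt_min_iff, h1]
    tauto
  have hmain : ((∑ l ∈ Finset.Ico L (2 * L),
        ‖∑ m ∈ Finset.range (N / l), a m * addChar (α * (l * (m + 1 : ℕ)))‖ ^ 2 : ℝ) : ℂ)
      = ∑ m₂ ∈ Finset.range T, ∑ m₁ ∈ Finset.range T, a m₁ * (starRingEnd ℂ) (a m₂) *
          ∑ l ∈ Finset.Ico L (min (2 * L) (N / (max (m₁ + 1) (m₂ + 1)) + 1)),
            addChar ((α * m₁ + -(α * m₂)) * l) := by
    rw [Complex.ofReal_sum, Finset.sum_congr rfl hsq, Finset.sum_comm]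
    refine Finset.sum_congr rfl fun m₂ _ => ?_
    rw [Finset.sum_comm]
    refine Finset.sum_congr rfl fun m₁ _ => ?_
    rw [← Finset.mul_sum, hint]
  have hnn : 0 ≤ ∑ l ∈ Finset.Ico L (2 * L),
      ‖∑ m ∈ Finset.range (N / l), a m * addChar (α * (l * (m + 1 : ℕ)))‖ ^ 2 :=
    Finset.sum_nonneg fun _ _ => by positivity
  rw [← abs_of_nonneg hnn, ← Real.norm_eq_abs, ← Complex.norm_real, hmain]
  refine (norm_sum_le _ _).trans (Finset.sum_le_sum fun m₂ h₂ => ?_)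
  refine (norm_sum_le _ _).trans (Finset.sum_le_sum fun m₁ h₁ => ?_)
  rw [norm_mul, norm_mul, RCLike.norm_conj, sq]
  have ha₁ := hA m₁ (Finset.mem_range.1 h₁)
  have ha₂ := hA m₂ (Finset.mem_range.1 h₂)
  have hA0 : 0 ≤ A := (norm_nonneg _).trans ha₁
  gcongr

theorem norm_sum_Ico_addChar_le (x : ℝ) (m n : ℕ) :
    ‖∑ i ∈ Finset.Ico m n, addChar (x * i)‖ ≤ (n - m : ℕ) := by
  refine (norm_sum_le _ _).trans (le_of_eq ?_)
  simp [norm_addChar]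

/-- The bound for a bilinear sum whose outer variable runs over one dyadic block. -/
theorem norm_bilinear_block_sq_le {α : ℝ} {c : ℤ} {r : ℕ} (hr : 2 ≤ r)
    (hcr : IsCoprime c (r : ℤ)) (hα : |α - c / r| ≤ 1 / (r : ℝ) ^ 2) (N L : ℕ) (hL : 0 < L)
    (a b : ℕ → ℂ) (A B : ℝ) (hA : ∀ m, m ≤ N → ‖a m‖ ≤ A) (hB : ∀ l, l < 2 * L → ‖b l‖ ≤ B) :
    ‖∑ l ∈ Finset.Ico L (2 * L), b l * ∑ m ∈ Finset.Ioc 0 (N / l), a m * addChar (α * (l * m))‖ ^ 2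
      ≤ (A * B) ^ 2 * N * ((4 * (N / L) / r + 1) * (2 * (L + r * (1 + Real.log r)))) := by
  have hlog : 0 ≤ Real.log r := Real.log_natCast_nonneg r
  have hL' : (0 : ℝ) < L := by exact_mod_cast hL
  set X : ℕ → ℂ := fun l =>
    ∑ m ∈ Finset.range (N / l), a (m + 1) * addChar (α * (l * (m + 1 : ℕ))) with hX
  have hTL : ((N / L : ℕ) : ℝ) ≤ N / L := Nat.cast_div_le
  have hXsq : ∑ l ∈ Finset.Ico L (2 * L), ‖X l‖ ^ 2
      ≤ (N / L) * (A ^ 2 * ((4 * (N / L) / r + 1) * (2 * (L + r * (1 + Real.log r))))) := by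
    refine (sum_norm_sq_range_div_le α N L hL (fun m => a (m + 1)) A ?_).trans ?_
    · intro m hm
      exact hA _ (by have := Nat.div_le_self N L; omega)
    have hinner : ∀ m₂ : ℕ, ∑ m₁ ∈ Finset.range (N / L), A ^ 2 *
        ‖∑ l ∈ Finset.Ico L (min (2 * L) (N / (max (m₁ + 1) (m₂ + 1)) + 1)),
          addChar ((α * m₁ + -(α * m₂)) * l)‖
        ≤ A ^ 2 * ((4 * (N / L) / r + 1) * (2 * (L + r * (1 + Real.log r)))) := by
      intro m₂
      rw [← Finset.mul_sum]
      refine mul_le_mul_of_nonneg_left ?_ (sq_nonneg A)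
      refine (sum_range_le_of_distNearestInt hr hcr hα (-(α * m₂)) L hL'.le _ (N / L)
        (fun _ => norm_nonneg _) (fun m₁ => ?_)
        (fun m₁ => norm_sum_Ico_addChar_mul_le _ _ _)).trans ?_
      · refine (norm_sum_Ico_addChar_le _ _ _).trans ?_
        exact_mod_cast (by omega :
          min (2 * L) (N / (max (m₁ + 1) (m₂ + 1)) + 1) - L ≤ L)
      · gcongr
    refine (Finset.sum_le_sum fun m₂ _ => hinner m₂).trans ?_
    rw [Finset.sum_const, Finset.card_range, nsmul_eq_mul]
    gcongr
  have hbsq : ∑ l ∈ Finset.Ico L (2 * L), ‖b l‖ ^ 2 ≤ L * B ^ 2 := by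
    calc ∑ l ∈ Finset.Ico L (2 * L), ‖b l‖ ^ 2 ≤ ∑ l ∈ Finset.Ico L (2 * L), B ^ 2 := by
          refine Finset.sum_le_sum fun l hl => ?_
          have := hB l (Finset.mem_Ico.1 hl).2
          gcongr
      _ = L * B ^ 2 := by simp [two_mul]
  have hnorm : ‖∑ l ∈ Finset.Ico L (2 * L),
      b l * ∑ m ∈ Finset.Ioc 0 (N / l), a m * addChar (α * (l * m))‖
      ≤ ∑ l ∈ Finset.Ico L (2 * L), ‖b l‖ * ‖X l‖ := by
    refine (norm_sum_le _ _).trans (le_of_eq (Finset.sum_congr rfl fun l _ => ?_))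
    rw [norm_mul, sum_Ioc_zero_eq_sum_range]
  calc _ ≤ (∑ l ∈ Finset.Ico L (2 * L), ‖b l‖ * ‖X l‖) ^ 2 := by gcongr
    _ ≤ (∑ l ∈ Finset.Ico L (2 * L), ‖b l‖ ^ 2) * ∑ l ∈ Finset.Ico L (2 * L), ‖X l‖ ^ 2 :=
        Finset.sum_mul_sq_le_sq_mul_sq _ _ _
    _ ≤ (L * B ^ 2) *
        ((N / L) * (A ^ 2 * ((4 * (N / L) / r + 1) * (2 * (L + r * (1 + Real.log r)))))) :=
        mul_le_mul hbsq hXsq (Finset.sum_nonneg fun _ _ => by positivity) (by positivity)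
    _ = _ := by field_simp

/-! ### The divisor bound -/

/-- The number of divisors of `n` is at most `C n ^ δ`: only the primes below `2 ^ (1 / δ)` can have
`e + 1 > p ^ (e δ)`, and for each of them the quotient is bounded in `e`. -/
theorem exists_card_divisors_le_rpow {δ : ℝ} (hδ : 0 < δ) :
    ∃ C : ℝ, 1 ≤ C ∧ ∀ n : ℕ, n ≠ 0 → (n.divisors.card : ℝ) ≤ C * (n : ℝ) ^ δ := by
  have hlog2 : 0 < Real.log 2 := Real.log_pos (by norm_num)
  set P : ℕ := ⌈(2 : ℝ) ^ (1 / δ)⌉₊ with hP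
  -- `K` bounds `(e + 1) / 2 ^ (e δ)`, as `2 ^ (e δ) ≥ 1 + e δ log 2`.
  set K : ℝ := 1 + 1 / (δ * Real.log 2) with hK
  have hK1 : 1 ≤ K := by
    have : 0 < 1 / (δ * Real.log 2) := by positivity
    linarith
  set k : ℕ → ℝ := fun p => if p < P then K else 1 with hk
  have hk0 : ∀ p, 0 ≤ k p := by
    intro p
    simp only [hk]
    split_ifs <;> linarith
  have hlocal : ∀ p e : ℕ, 2 ≤ p → ((e + 1 : ℕ) : ℝ) ≤ k p * ((p : ℝ) ^ e) ^ δ := by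
    intro p e hp
    have hp' : (2 : ℝ) ≤ p := by exact_mod_cast hp
    rw [← Real.rpow_natCast, ← Real.rpow_mul (by positivity), mul_comm (e : ℝ) δ]
    simp only [hk]
    split_ifs with h
    · have h1 : 1 + e * (δ * Real.log 2) ≤ (p : ℝ) ^ (δ * e) := by
        calc 1 + e * (δ * Real.log 2) ≤ Real.exp (e * (δ * Real.log 2)) := by
              linarith [Real.add_one_le_exp (e * (δ * Real.log 2))]
          _ = (2 : ℝ) ^ (δ * e) := by
              rw [Real.rpow_def_of_pos (by norm_num)]
              ring_nf
          _ ≤ (p : ℝ) ^ (δ * e) := by gcongr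
      calc ((e + 1 : ℕ) : ℝ) ≤ K * (1 + e * (δ * Real.log 2)) := by
            have : K * (1 + e * (δ * Real.log 2))
                = 1 + e * (δ * Real.log 2) + 1 / (δ * Real.log 2) + e := by
              rw [hK]
              field_simp
              ring
            rw [this]
            push_cast
            have h2 : 0 ≤ e * (δ * Real.log 2) := by positivity
            have h3 : 0 ≤ 1 / (δ * Real.log 2) := by positivity
            linarith
        _ ≤ _ := by gcongr
    · rw [one_mul, Real.rpow_mul (by positivity), Real.rpow_natCast]
      have h1 : (2 : ℝ) ≤ (p : ℝ) ^ δ := by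
        have h2 : (2 : ℝ) ^ (1 / δ) ≤ p :=
          (Nat.le_ceil _).trans (by exact_mod_cast not_lt.1 h)
        calc (2 : ℝ) = ((2 : ℝ) ^ (1 / δ)) ^ δ := by
              rw [← Real.rpow_mul (by norm_num), one_div_mul_cancel hδ.ne', Real.rpow_one]
          _ ≤ _ := by gcongr
      calc ((e + 1 : ℕ) : ℝ) ≤ (2 : ℝ) ^ e := by exact_mod_cast e.lt_two_pow_self
        _ ≤ _ := by gcongr
  refine ⟨K ^ P, one_le_pow₀ hK1, fun n hn => ?_⟩
  have hfac : ((n : ℝ)) ^ δ = ∏ p ∈ n.primeFactors, ((p : ℝ) ^ n.factorization p) ^ δ := by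
    rw [Real.finsetProd_rpow _ _ fun p _ => by positivity]
    congr 1
    conv_lhs => rw [← Nat.prod_factorization_pow_eq_self hn]
    rw [Finsupp.prod, Nat.support_factorization]
    push_cast
    rfl
  have hkP : ∏ p ∈ n.primeFactors, k p ≤ K ^ P := by
    rw [← Finset.prod_filter, Finset.prod_const]
    refine pow_le_pow_right₀ hK1 ?_
    refine (Finset.card_le_card (t := Finset.range P) fun p hp => ?_).trans (by simp)
    exact Finset.mem_range.2 (Finset.mem_filter.1 hp).2
  rw [Nat.card_divisors hn, Nat.cast_prod]
  calc ∏ p ∈ n.primeFactors, ((n.factorization p + 1 : ℕ) : ℝ)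
      ≤ ∏ p ∈ n.primeFactors, k p * ((p : ℝ) ^ n.factorization p) ^ δ :=
        Finset.prod_le_prod (fun _ _ => by positivity) fun p hp =>
          hlocal p _ (Nat.prime_of_mem_primeFactors hp).two_le
    _ = (∏ p ∈ n.primeFactors, k p) * (n : ℝ) ^ δ := by rw [Finset.prod_mul_distrib, hfac]
    _ ≤ K ^ P * (n : ℝ) ^ δ := by gcongr

/-! ### Vaughan's identity -/

namespace ArithmeticFunction

/-- The restriction of an arithmetic function to the integers `n ≤ U`, extended by zero. -/
def truncate (f : ArithmeticFunction ℝ) (U : ℕ) : ArithmeticFunction ℝ :=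
  ⟨fun n => if n ≤ U then f n else 0, by simp⟩

theorem truncate_apply (f : ArithmeticFunction ℝ) (U n : ℕ) :
    f.truncate U n = if n ≤ U then f n else 0 := rfl

theorem sub_truncate_apply (f : ArithmeticFunction ℝ) (U n : ℕ) :
    (f - f.truncate U) n = if n ≤ U then 0 else f n := by
  change f n - f.truncate U n = _
  rw [truncate_apply]
  split_ifs <;> simp

/-- Vaughan's identity, in the ring of arithmetic functions. -/
theorem vonMangoldt_eq_vaughan (U V : ℕ) :
    vonMangoldt = vonMangoldt.truncate U
      + (moebius : ArithmeticFunction ℝ).truncate V * log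
      - ((moebius : ArithmeticFunction ℝ).truncate V * vonMangoldt.truncate U)
        * (zeta : ArithmeticFunction ℝ)
      + (((moebius : ArithmeticFunction ℝ) - (moebius : ArithmeticFunction ℝ).truncate V)
        * (zeta : ArithmeticFunction ℝ)) * (vonMangoldt - vonMangoldt.truncate U) := by
  have h1 : (moebius : ArithmeticFunction ℝ) * (zeta : ArithmeticFunction ℝ) = 1 :=
    coe_moebius_mul_coe_zeta
  have h2 := vonMangoldt_mul_zeta
  linear_combination (-vonMangoldt + vonMangoldt.truncate U) * h1
    + (moebius : ArithmeticFunction ℝ).truncate V * h2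

theorem abs_truncate_moebius_le (V n : ℕ) :
    |(moebius : ArithmeticFunction ℝ).truncate V n| ≤ 1 := by
  rw [truncate_apply]
  split_ifs
  · rw [intCoe_apply]
    exact_mod_cast abs_moebius_le_one
  · simp

theorem abs_truncate_vonMangoldt_le (U n : ℕ) : |vonMangoldt.truncate U n| ≤ vonMangoldt n := by
  rw [truncate_apply]
  split_ifs
  · exact (abs_of_nonneg vonMangoldt_nonneg).le
  · simp

theorem abs_truncate_moebius_mul_truncate_vonMangoldt_le (U V n : ℕ) :
    |((moebius : ArithmeticFunction ℝ).truncate V * vonMangoldt.truncate U) n| ≤ Real.log n := by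
  rw [mul_apply]
  refine (Finset.abs_sum_le_sum_abs _ _).trans ?_
  rw [← vonMangoldt_sum, ← Nat.sum_divisorsAntidiagonal' (fun _ i => vonMangoldt i)]
  refine Finset.sum_le_sum fun x _ => ?_
  rw [abs_mul]
  calc _ ≤ 1 * vonMangoldt x.2 :=
        mul_le_mul (abs_truncate_moebius_le _ _) (abs_truncate_vonMangoldt_le _ _)
          (abs_nonneg _) zero_le_one
    _ = _ := one_mul _

theorem truncate_mul_truncate_eq_zero (f g : ArithmeticFunction ℝ) {U V n : ℕ} (h : V * U < n) :
    (f.truncate V * g.truncate U) n = 0 := by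
  rw [mul_apply]
  refine Finset.sum_eq_zero fun x hx => ?_
  rw [truncate_apply, truncate_apply]
  have hx' := (Nat.mem_divisorsAntidiagonal.1 hx).1
  by_cases h1 : x.1 ≤ V <;> by_cases h2 : x.2 ≤ U <;> simp [h1, h2]
  have := Nat.mul_le_mul h1 h2
  omega

theorem abs_sub_truncate_moebius_mul_zeta_le (V n : ℕ) :
    |(((moebius : ArithmeticFunction ℝ) - (moebius : ArithmeticFunction ℝ).truncate V)
        * (zeta : ArithmeticFunction ℝ)) n| ≤ n.divisors.card := by
  rw [coe_mul_zeta_apply, Finset.card_eq_sum_ones, Nat.cast_sum]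
  refine (Finset.abs_sum_le_sum_abs _ _).trans (Finset.sum_le_sum fun d _ => ?_)
  rw [sub_truncate_apply]
  split_ifs
  · simp
  · rw [intCoe_apply]
    exact_mod_cast abs_moebius_le_one

theorem sub_truncate_mul_zeta_eq_zero (f : ArithmeticFunction ℝ) {V n : ℕ} (h : n ≤ V) :
    ((f - f.truncate V) * (zeta : ArithmeticFunction ℝ)) n = 0 := by
  rw [coe_mul_zeta_apply]
  refine Finset.sum_eq_zero fun d hd => ?_
  rw [sub_truncate_apply, if_pos ((Nat.divisor_le hd).trans h)]

end ArithmeticFunction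

/-! ### The exponential sum over primes -/

/-- The exponential sum `∑ f(n) e(α n)` over `1 ≤ n ≤ N`. -/
noncomputable def expSum (α : ℝ) (N : ℕ) (f : ArithmeticFunction ℝ) : ℂ :=
  ∑ n ∈ Finset.Ioc 0 N, (f n : ℂ) * addChar (α * n)

theorem expSum_add (α : ℝ) (N : ℕ) (f g : ArithmeticFunction ℝ) :
    expSum α N (f + g) = expSum α N f + expSum α N g := by
  simp [expSum, add_mul, Finset.sum_add_distrib]

theorem expSum_sub (α : ℝ) (N : ℕ) (f g : ArithmeticFunction ℝ) :
    expSum α N (f - g) = expSum α N f - expSum α N g := by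
  have := expSum_add α N (f - g) g
  rw [sub_add_cancel] at this
  rw [this, add_sub_cancel_right]

theorem expSum_mul (α : ℝ) (N : ℕ) (f g : ArithmeticFunction ℝ) :
    expSum α N (f * g) = ∑ d ∈ Finset.Ioc 0 N, (f d : ℂ) *
      ∑ m ∈ Finset.Ioc 0 (N / d), (g m : ℂ) * addChar (α * (d * m)) := by
  have h1 : expSum α N (f * g) = ∑ n ∈ Finset.Ioc 0 N,
      ∑ x ∈ Finset.Ioc 0 N ×ˢ Finset.Ioc 0 N with x.1 * x.2 = n,
        (f x.1 : ℂ) * ((g x.2 : ℂ) * addChar (α * (x.1 * x.2))) := by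
    refine Finset.sum_congr rfl fun n hn => ?_
    rw [Finset.mem_Ioc] at hn
    rw [ArithmeticFunction.mul_apply, Nat.divisorsAntidiagonal_eq_prod_filter_of_le hn.1.ne' hn.2,
      Complex.ofReal_sum, Finset.sum_mul]
    refine Finset.sum_congr rfl fun x hx => ?_
    rw [← (Finset.mem_filter.1 hx).2]
    push_cast
    ring
  rw [h1]
  simp_rw [Finset.sum_filter, Finset.mul_sum]
  rw [Finset.sum_comm, Finset.sum_product]
  refine Finset.sum_congr rfl fun d hd => ?_
  rw [Finset.mem_Ioc] at hd
  have h2 : Finset.Ioc 0 (N / d) = (Finset.Ioc 0 N).filter fun m => d * m ≤ N := by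
    ext m
    have h3 : m ≤ N / d ↔ d * m ≤ N := by rw [Nat.le_div_iff_mul_le hd.1, mul_comm]
    simp only [Finset.mem_Ioc, Finset.mem_filter, h3]
    have h4 : d * m ≤ N → m ≤ N := fun h => (Nat.le_mul_of_pos_left m hd.1).trans h
    tauto
  rw [h2, Finset.sum_filter]
  refine Finset.sum_congr rfl fun m hm => ?_
  rw [Finset.mem_Ioc] at hm
  rw [Finset.sum_ite_eq]
  have : d * m ∈ Finset.Ioc 0 N ↔ d * m ≤ N := by
    rw [Finset.mem_Ioc]
    exact and_iff_right (Nat.mul_pos hd.1 hm.1)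
  simp only [this]

/-- Summation by parts against a monotone weight. -/
theorem norm_sum_range_mul_le_of_monotone (n : ℕ) (g : ℕ → ℝ) (hg : Monotone g) (hg0 : 0 ≤ g 0)
    (z : ℕ → ℂ) (R : ℝ) (hR : ∀ j, ‖∑ i ∈ Finset.range j, z i‖ ≤ R) :
    ‖∑ i ∈ Finset.range n, (g i : ℂ) * z i‖ ≤ 2 * g (n - 1) * R := by
  have hg0' : ∀ i, 0 ≤ g i := fun i => hg0.trans (hg (Nat.zero_le i))
  have hR0 : 0 ≤ R := (norm_nonneg _).trans (hR 0)
  have h := Finset.sum_range_by_parts (fun i => (g i : ℂ)) z n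
  simp only [smul_eq_mul] at h
  rw [h]
  refine (norm_sub_le _ _).trans ?_
  have h1 : ‖(g (n - 1) : ℂ) * ∑ i ∈ Finset.range n, z i‖ ≤ g (n - 1) * R := by
    rw [norm_mul, Complex.norm_real, Real.norm_eq_abs, abs_of_nonneg (hg0' _)]
    exact mul_le_mul_of_nonneg_left (hR n) (hg0' _)
  have h2 : ‖∑ i ∈ Finset.range (n - 1),
      ((g (i + 1) : ℂ) - g i) * ∑ i ∈ Finset.range (i + 1), z i‖ ≤ g (n - 1) * R := by
    refine (norm_sum_le _ _).trans ?_
    calc _ ≤ ∑ i ∈ Finset.range (n - 1), (g (i + 1) - g i) * R := by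
          refine Finset.sum_le_sum fun i _ => ?_
          have hi : 0 ≤ g (i + 1) - g i := sub_nonneg.2 (hg (Nat.le_succ i))
          rw [norm_mul, ← Complex.ofReal_sub, Complex.norm_real, Real.norm_eq_abs,
            abs_of_nonneg hi]
          exact mul_le_mul_of_nonneg_left (hR _) hi
      _ = (g (n - 1) - g 0) * R := by rw [← Finset.sum_mul, Finset.sum_range_sub]
      _ ≤ g (n - 1) * R := by gcongr; linarith
  linarith

/-- A convolution whose first factor is supported on `d ≤ D` with `D ≤ r / 2`: for each such `d`,
the number `α d` is at distance at least `1 / (2r)` from the integers, so that the sum over the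
second variable is at most `r` times the size of the smooth weight. -/
theorem norm_expSum_mul_le_of_support {α : ℝ} {c : ℤ} {r : ℕ} (hr : 0 < r)
    (hcr : IsCoprime c (r : ℤ)) (hα : |α - c / r| ≤ 1 / (r : ℝ) ^ 2) (N D : ℕ) (hD : 2 * D ≤ r)
    (f g : ArithmeticFunction ℝ) (A : ℝ) (hA0 : 0 ≤ A) (hfD : ∀ d, D < d → f d = 0)
    (hfA : ∀ d, d ≠ 0 → d ≤ N → |f d| ≤ A) (hg : Monotone g) :
    ‖expSum α N (f * g)‖ ≤ D * (A * (2 * g N * r)) := by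
  have hr' : (0 : ℝ) < r := by exact_mod_cast hr
  have hg0 : ∀ i, 0 ≤ g i := fun i => by
    have := hg (Nat.zero_le i)
    rwa [ArithmeticFunction.map_zero] at this
  have hinner : ∀ d ∈ Finset.Ioc 0 D,
      ‖∑ m ∈ Finset.Ioc 0 (N / d), (g m : ℂ) * addChar (α * (d * m))‖ ≤ 2 * g N * r := by
    intro d hd
    rw [Finset.mem_Ioc] at hd
    have hdist := one_div_two_mul_le_distNearestInt hr hcr hα (h := (d : ℤ)) (by omega)
      (by rw [Nat.abs_cast]; omega)
    rw [Int.cast_natCast] at hdist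
    have hpart : ∀ j, ‖∑ i ∈ Finset.range j, addChar (α * (d * (i + 1 : ℕ)))‖ ≤ r := by
      intro j
      have h1 := norm_sum_Ico_addChar_mul_le (α * d) 1 (j + 1)
      have h2 : ∑ i ∈ Finset.Ico 1 (j + 1), addChar (α * d * i)
          = ∑ i ∈ Finset.range j, addChar (α * (d * (i + 1 : ℕ))) := by
        rw [Finset.sum_Ico_eq_sum_range, Nat.add_sub_cancel]
        refine Finset.sum_congr rfl fun i _ => ?_
        rw [add_comm 1 i, mul_assoc]
      rw [h2] at h1
      have h3 := (mul_le_mul_of_nonneg_left hdist (norm_nonneg _)).trans h1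
      rw [mul_one_div, div_le_iff₀ (by positivity)] at h3
      linarith
    rw [sum_Ioc_zero_eq_sum_range]
    rcases Nat.eq_zero_or_pos (N / d) with h0 | h0
    · rw [h0, Finset.sum_range_zero, norm_zero]
      have := hg0 N
      positivity
    · refine (norm_sum_range_mul_le_of_monotone (N / d) (fun i => g (i + 1))
        (fun i j hij => hg (by omega)) (hg0 _) _ r hpart).trans ?_
      gcongr
      exact hg (by have := Nat.div_le_self N d; omega)
  have hR : 0 ≤ A * (2 * g N * r) := by
    have := hg0 N
    positivity
  rw [expSum_mul]
  calc _ ≤ ∑ d ∈ Finset.Ioc 0 N, if d ≤ D then A * (2 * g N * r) else 0 := by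
        refine (norm_sum_le _ _).trans (Finset.sum_le_sum fun d hd => ?_)
        rw [Finset.mem_Ioc] at hd
        split_ifs with h
        · rw [norm_mul, Complex.norm_real, Real.norm_eq_abs]
          exact mul_le_mul (hfA d hd.1.ne' hd.2) (hinner d (Finset.mem_Ioc.2 ⟨hd.1, h⟩))
            (norm_nonneg _) hA0
        · rw [hfD d (not_le.1 h)]
          simp
    _ ≤ ∑ d ∈ Finset.Ioc 0 D, A * (2 * g N * r) := by
        rw [← Finset.sum_filter]
        refine Finset.sum_le_sum_of_subset_of_nonneg (fun d hd => ?_) fun _ _ _ => hR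
        simp only [Finset.mem_filter, Finset.mem_Ioc] at hd ⊢
        exact ⟨hd.1.1, hd.2⟩
    _ = D * (A * (2 * g N * r)) := by simp

theorem sum_Ico_one_two_pow {M : Type*} [AddCommMonoid M] (h : ℕ → M) (J : ℕ) :
    ∑ l ∈ Finset.Ico 1 (2 ^ J), h l
      = ∑ i ∈ Finset.range J, ∑ l ∈ Finset.Ico (2 ^ i) (2 * 2 ^ i), h l := by
  induction J with
  | zero => simp
  | succ J ih =>
    rw [Finset.sum_range_succ, ← ih, pow_succ, mul_comm (2 ^ J) 2,
      Finset.sum_Ico_consecutive _ Nat.one_le_two_pow (by omega)]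

/-- The arithmetic of one dyadic block: `L` is the size of the outer variable, and both variables
exceed a multiple of `√r`. -/
theorem bilinear_block_bound {N L r s : ℕ} (hL : 0 < L) (hr : 2 ≤ r) (hrN : r ^ 2 ≤ N)
    (hs : r ≤ 2 * (s + 1) ^ 2) (hsL : s + 1 ≤ 2 * L) (hLN : L * (s + 1) ≤ N) :
    (N : ℝ) * ((4 * (N / L) / r + 1) * (2 * (L + r * (1 + Real.log r))))
      ≤ 49 * (1 + Real.log N) * (N * (r : ℝ) ^ (-(1 / 4) : ℝ)) ^ 2 := by
  have hr0 : (0 : ℝ) < r := by positivity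
  have hL0 : (0 : ℝ) < L := by exact_mod_cast hL
  have hN1 : 1 ≤ N := le_trans (by nlinarith) hrN
  have hN0 : (0 : ℝ) < N := by exact_mod_cast hN1
  have hr1 : (1 : ℝ) ≤ r := by exact_mod_cast (by omega : 1 ≤ r)
  set x : ℝ := Real.sqrt r with hx
  have hx0 : 0 < x := Real.sqrt_pos.2 hr0
  have hx1 : 1 ≤ x := Real.one_le_sqrt.2 hr1
  have hxx : x * x = r := Real.mul_self_sqrt hr0.le
  set ℓ : ℝ := 1 + Real.log N with hℓ
  have hℓ1 : 1 ≤ ℓ := by have := Real.log_natCast_nonneg N; linarith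
  have hrN' : (r : ℝ) ^ 2 ≤ N := by exact_mod_cast hrN
  have hlr : 1 + Real.log r ≤ ℓ := by
    have : Real.log r ≤ Real.log N := by
      refine Real.log_le_log hr0 ?_
      nlinarith
    linarith
  have hlr0 : 0 ≤ 1 + Real.log r := by have := Real.log_natCast_nonneg r; linarith
  have hpow : (N * (r : ℝ) ^ (-(1 / 4) : ℝ)) ^ 2 = N ^ 2 / x := by
    have h1 : ((r : ℝ) ^ (-(1 / 4) : ℝ)) ^ 2 = x⁻¹ := by
      rw [← Real.rpow_natCast, ← Real.rpow_mul hr0.le, hx, Real.sqrt_eq_rpow,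
        ← Real.rpow_neg hr0.le]
      norm_num
    rw [mul_pow, h1, div_eq_mul_inv]
  rw [hpow]
  have hxs : x ≤ 2 * (s + 1) := by
    have h1 : (r : ℝ) ≤ 2 * (s + 1) ^ 2 := by exact_mod_cast hs
    have h2 : (0 : ℝ) ≤ s := Nat.cast_nonneg s
    rw [hx]
    refine Real.sqrt_le_iff.2 ⟨by positivity, ?_⟩
    nlinarith
  have hsL' : (s + 1 : ℝ) ≤ 2 * L := by exact_mod_cast hsL
  have hLN' : (L : ℝ) * (s + 1) ≤ N := by exact_mod_cast hLN
  have e1 : (N : ℝ) * ((4 * (N / L) / r + 1) * (2 * (L + r * (1 + Real.log r))))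
      = 2 * (4 * (N ^ 2 / r) + 4 * (N ^ 2 / L) * (1 + Real.log r) + N * L
        + N * r * (1 + Real.log r)) := by
    field_simp
    ring
  have hNx : 0 ≤ (N : ℝ) ^ 2 / x := by positivity
  have t1 : (N : ℝ) ^ 2 / r ≤ N ^ 2 / x := by
    gcongr
    nlinarith
  have t2 : (N : ℝ) ^ 2 / L ≤ 4 * (N ^ 2 / x) := by
    rw [← mul_div_assoc, div_le_div_iff₀ hL0 hx0]
    have : x ≤ 4 * L := by linarith
    nlinarith [sq_nonneg (N : ℝ)]
  have t3 : (N : ℝ) * L ≤ 2 * (N ^ 2 / x) := by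
    rw [← mul_div_assoc, le_div_iff₀ hx0]
    have : (L : ℝ) * x ≤ 2 * N := by nlinarith
    nlinarith
  have t4 : (N : ℝ) * r ≤ N ^ 2 / x := by
    rw [le_div_iff₀ hx0]
    have : (r : ℝ) * x ≤ N := by nlinarith
    nlinarith
  have t2' : (N : ℝ) ^ 2 / L * (1 + Real.log r) ≤ 4 * (N ^ 2 / x) * ℓ :=
    mul_le_mul t2 hlr hlr0 (by positivity)
  have t4' : (N : ℝ) * r * (1 + Real.log r) ≤ N ^ 2 / x * ℓ :=
    mul_le_mul t4 hlr hlr0 hNx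
  rw [e1]
  have t5 : (N : ℝ) ^ 2 / x ≤ N ^ 2 / x * ℓ := le_mul_of_one_le_right hNx hℓ1
  have t6 : 0 ≤ (N : ℝ) ^ 2 / x * ℓ := by positivity
  linarith

/-- The bilinear part of Vaughan's identity: both factors vanish up to `s`, where `s` is of order
`√r`, and the sum is split dyadically. -/
theorem norm_expSum_bilinear_le {α : ℝ} {c : ℤ} {r : ℕ} (hr : 2 ≤ r)
    (hcr : IsCoprime c (r : ℤ)) (hα : |α - c / r| ≤ 1 / (r : ℝ) ^ 2) (N s : ℕ)
    (hrN : r ^ 2 ≤ N) (hs : r ≤ 2 * (s + 1) ^ 2) (f g : ArithmeticFunction ℝ) (A B : ℝ)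
    (hA0 : 0 ≤ A) (hB0 : 0 ≤ B) (hf : ∀ n, n ≤ s → f n = 0) (hg : ∀ n, n ≤ s → g n = 0)
    (hfB : ∀ n, n ≤ 2 * N → |f n| ≤ B) (hgA : ∀ n, n ≤ N → |g n| ≤ A) :
    ‖expSum α N (f * g)‖ ≤
      14 * A * B * (1 + Real.log N) ^ 2 * (N * (r : ℝ) ^ (-(1 / 4) : ℝ)) := by
  have hN1 : 1 ≤ N := le_trans (by nlinarith) hrN
  set ℓ : ℝ := 1 + Real.log N with hℓ
  have hℓ1 : 1 ≤ ℓ := by have := Real.log_natCast_nonneg N; linarith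
  set W : ℝ := N * (r : ℝ) ^ (-(1 / 4) : ℝ) with hW
  have hW0 : 0 ≤ W := by positivity
  set h : ℕ → ℂ := fun l => (f l : ℂ) *
    ∑ m ∈ Finset.Ioc 0 (N / l), (g m : ℂ) * addChar (α * (l * m)) with hh
  set J : ℕ := Nat.log 2 N + 1 with hJ
  have hNJ : N < 2 ^ J := Nat.lt_pow_succ_log_self (by norm_num) N
  have hsum : expSum α N (f * g)
      = ∑ i ∈ Finset.range J, ∑ l ∈ Finset.Ico (2 ^ i) (2 * 2 ^ i), h l := by
    rw [expSum_mul, ← sum_Ico_one_two_pow]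
    refine Finset.sum_subset (fun l hl => ?_) fun l hl hl' => ?_
    · rw [Finset.mem_Ioc] at hl
      exact Finset.mem_Ico.2 ⟨hl.1, by omega⟩
    · rw [Finset.mem_Ico] at hl
      rw [Finset.mem_Ioc] at hl'
      rw [Nat.div_eq_of_lt (by omega)]
      simp
  have hblock : ∀ i, ‖∑ l ∈ Finset.Ico (2 ^ i) (2 * 2 ^ i), h l‖ ≤ 7 * A * B * ℓ * W := by
    intro i
    have hL : 0 < 2 ^ i := by positivity
    -- A block contributes only if it meets `l > s` and leaves room for some `m > s`.
    by_cases h1 : s + 1 ≤ 2 * 2 ^ i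
    swap
    · rw [Finset.sum_eq_zero, norm_zero]
      · positivity
      · intro l hl
        rw [Finset.mem_Ico] at hl
        simp only [hh]
        rw [hf l (by omega)]
        simp
    by_cases h2 : 2 ^ i * (s + 1) ≤ N
    swap
    · rw [Finset.sum_eq_zero, norm_zero]
      · positivity
      · intro l hl
        rw [Finset.mem_Ico] at hl
        simp only [hh]
        rw [Finset.sum_eq_zero, mul_zero]
        intro m hm
        rw [Finset.mem_Ioc, Nat.le_div_iff_mul_le (by omega)] at hm
        rw [hg m, Complex.ofReal_zero, zero_mul]
        by_contra h3
        have : 2 ^ i * (s + 1) ≤ m * l := by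
          rw [mul_comm]
          exact Nat.mul_le_mul (by omega) hl.1
        omega
    have hLN : 2 ^ i ≤ N := le_trans (Nat.le_mul_of_pos_right _ (by omega)) h2
    have hb := norm_bilinear_block_sq_le hr hcr hα N (2 ^ i) hL (fun m => (g m : ℂ))
      (fun l => (f l : ℂ)) A B
      (fun m hm => by rw [Complex.norm_real]; exact hgA m hm)
      (fun l hl => by rw [Complex.norm_real]; exact hfB l (by omega))
    have hc := bilinear_block_bound hL hr hrN hs h1 h2
    refine le_of_sq_le_sq ?_ (by positivity)
    calc _ ≤ _ := hb
      _ ≤ (A * B) ^ 2 * (49 * ℓ * W ^ 2) := by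
          rw [mul_assoc]
          exact mul_le_mul_of_nonneg_left hc (sq_nonneg _)
      _ ≤ (A * B) ^ 2 * (49 * (ℓ * ℓ) * W ^ 2) := by
          gcongr
          exact le_mul_of_one_le_left (by linarith) hℓ1
      _ = (7 * A * B * ℓ * W) ^ 2 := by ring
  have hJℓ : (J : ℝ) ≤ 2 * ℓ := by
    have h1 : (Nat.log 2 N : ℝ) ≤ Real.logb 2 N := Real.natLog_le_logb N 2
    have h2 : Real.logb 2 N ≤ 2 * Real.log N := by
      rw [Real.logb, div_le_iff₀ (Real.log_pos (by norm_num))]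
      have := Real.log_two_gt_d9
      nlinarith [Real.log_natCast_nonneg N]
    rw [hJ]
    push_cast
    linarith
  rw [hsum]
  calc _ ≤ ∑ i ∈ Finset.range J, 7 * A * B * ℓ * W :=
        (norm_sum_le _ _).trans (Finset.sum_le_sum fun i _ => hblock i)
    _ = J * (7 * A * B * ℓ * W) := by simp
    _ ≤ 2 * ℓ * (7 * A * B * ℓ * W) := by gcongr
    _ = _ := by ring

theorem norm_expSum_truncate_le (α : ℝ) (N s : ℕ) (f : ArithmeticFunction ℝ) (A : ℝ) (hA0 : 0 ≤ A)
    (hfA : ∀ n, n ≤ N → |f n| ≤ A) : ‖expSum α N (f.truncate s)‖ ≤ s * A := by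
  calc ‖expSum α N (f.truncate s)‖ ≤ ∑ n ∈ Finset.Ioc 0 N, if n ≤ s then A else 0 := by
        refine (norm_sum_le _ _).trans (Finset.sum_le_sum fun n hn => ?_)
        rw [norm_mul, norm_addChar, mul_one, Complex.norm_real, Real.norm_eq_abs,
          ArithmeticFunction.truncate_apply]
        split_ifs
        · exact hfA n (Finset.mem_Ioc.1 hn).2
        · simp
    _ ≤ ∑ n ∈ Finset.Ioc 0 s, A := by
        rw [← Finset.sum_filter]
        refine Finset.sum_le_sum_of_subset_of_nonneg (fun n hn => ?_) fun _ _ _ => hA0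
        simp only [Finset.mem_filter, Finset.mem_Ioc] at hn ⊢
        exact ⟨hn.1.1, hn.2⟩
    _ = s * A := by simp

open ArithmeticFunction in
/-- Vaughan's identity is applied with both parameters equal to `s = ⌊√(r / 2)⌋`. -/
theorem norm_expSum_vonMangoldt_le {α : ℝ} {c : ℤ} {r : ℕ} (hr : 2 ≤ r)
    (hcr : IsCoprime c (r : ℤ)) (hα : |α - c / r| ≤ 1 / (r : ℝ) ^ 2) (N : ℕ) (hrN : r ^ 2 ≤ N)
    (B : ℝ) (hB : ∀ n : ℕ, n ≠ 0 → n ≤ 2 * N → (n.divisors.card : ℝ) ≤ B) :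
    ‖expSum α N vonMangoldt‖ ≤
      14 * (1 + Real.log N) ^ 3 * (r ^ 2 + B * (N * (r : ℝ) ^ (-(1 / 4) : ℝ))) := by
  have hN1 : 1 ≤ N := le_trans (by nlinarith) hrN
  set s : ℕ := Nat.sqrt (r / 2) with hs
  have hs1 : s * s ≤ r / 2 := Nat.sqrt_le _
  have hs2 : r / 2 < (s + 1) * (s + 1) := Nat.lt_succ_sqrt _
  have hs3 : r ≤ 2 * (s + 1) ^ 2 := by rw [sq]; omega
  have hs4 : s ≤ s * s := Nat.le_mul_self s
  have hB0 : 0 ≤ B := by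
    have := hB 1 one_ne_zero (by omega)
    exact (Nat.cast_nonneg _).trans this
  set ℓ : ℝ := 1 + Real.log N with hℓ
  have hlogN : 0 ≤ Real.log N := Real.log_natCast_nonneg N
  have hℓ1 : 1 ≤ ℓ := by linarith
  have hlog : ∀ n : ℕ, n ≤ N → Real.log n ≤ Real.log N := by
    intro n hn
    rcases Nat.eq_zero_or_pos n with rfl | hn0
    · simpa using hlogN
    · exact Real.log_le_log (by exact_mod_cast hn0) (by exact_mod_cast hn)
  have hΛ : ∀ n : ℕ, n ≤ N → |vonMangoldt n| ≤ Real.log N := fun n hn => by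
    rw [abs_of_nonneg vonMangoldt_nonneg]
    exact vonMangoldt_le_log.trans (hlog n hn)
  set W : ℝ := N * (r : ℝ) ^ (-(1 / 4) : ℝ) with hW
  have hW0 : 0 ≤ W := by positivity
  have hsr : (s : ℝ) ≤ r / 2 := by
    rw [le_div_iff₀ (by norm_num)]
    exact_mod_cast (by omega : s * 2 ≤ r)
  have hssr : ((s * s : ℕ) : ℝ) ≤ r / 2 := by
    rw [le_div_iff₀ (by norm_num)]
    exact_mod_cast (by omega : s * s * 2 ≤ r)
  have hr1 : (1 : ℝ) ≤ r := by exact_mod_cast (by omega : 1 ≤ r)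
  have E0 := norm_expSum_truncate_le α N s vonMangoldt (Real.log N) hlogN hΛ
  have E1 := norm_expSum_mul_le_of_support (by omega) hcr hα N s (by omega)
    ((moebius : ArithmeticFunction ℝ).truncate s) log 1 zero_le_one
    (fun d hd => by rw [truncate_apply, if_neg (by omega)])
    (fun d _ _ => abs_truncate_moebius_le s d)
    (fun m n hmn => by
      rw [log_apply, log_apply]
      rcases Nat.eq_zero_or_pos m with rfl | hm
      · simpa using Real.log_natCast_nonneg n
      · exact Real.log_le_log (by exact_mod_cast hm) (by exact_mod_cast hmn))
  have E2 := norm_expSum_mul_le_of_support (by omega) hcr hα N (s * s) (by omega)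
    ((moebius : ArithmeticFunction ℝ).truncate s * vonMangoldt.truncate s)
    (zeta : ArithmeticFunction ℝ) (Real.log N) hlogN
    (fun d hd => truncate_mul_truncate_eq_zero _ _ hd)
    (fun d _ hd => (abs_truncate_moebius_mul_truncate_vonMangoldt_le s s d).trans (hlog d hd))
    (fun m n hmn => by
      simp only [natCoe_apply, zeta_apply]
      split_ifs <;> simp
      omega)
  have E3 := norm_expSum_bilinear_le hr hcr hα N s hrN hs3
    (((moebius : ArithmeticFunction ℝ) - (moebius : ArithmeticFunction ℝ).truncate s)
        * (zeta : ArithmeticFunction ℝ)) (vonMangoldt - vonMangoldt.truncate s) (Real.log N) B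
    hlogN hB0 (fun n hn => sub_truncate_mul_zeta_eq_zero _ hn)
    (fun n hn => by rw [sub_truncate_apply, if_pos hn])
    (fun n hn => by
      rcases eq_or_ne n 0 with rfl | hn0
      · simpa using hB0
      · exact (abs_sub_truncate_moebius_mul_zeta_le s n).trans (hB n hn0 hn))
    (fun n hn => by
      rw [sub_truncate_apply]
      split_ifs
      · simpa using hlogN
      · exact hΛ n hn)
  rw [log_apply] at E1
  rw [natCoe_apply, zeta_apply, if_neg (by omega), Nat.cast_one] at E2
  have hlℓ : Real.log N ≤ ℓ := by linarith
  have hℓ3 : ℓ ≤ ℓ ^ 3 := le_self_pow₀ hℓ1 (by norm_num)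
  have F0 : (s : ℝ) * Real.log N ≤ r ^ 2 * ℓ := by
    refine mul_le_mul ?_ hlℓ hlogN (by positivity)
    nlinarith
  have F1 : (s : ℝ) * (1 * (2 * Real.log N * r)) ≤ r ^ 2 * ℓ := by
    calc (s : ℝ) * (1 * (2 * Real.log N * r)) ≤ r / 2 * (1 * (2 * ℓ * r)) := by gcongr
      _ = r ^ 2 * ℓ := by ring
  have F2 : ((s * s : ℕ) : ℝ) * (Real.log N * (2 * 1 * r)) ≤ r ^ 2 * ℓ := by
    calc ((s * s : ℕ) : ℝ) * (Real.log N * (2 * 1 * r)) ≤ r / 2 * (ℓ * (2 * 1 * r)) := by gcongr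
      _ = r ^ 2 * ℓ := by ring
  have F3 : 14 * Real.log N * B * ℓ ^ 2 * W ≤ 14 * ℓ ^ 3 * (B * W) := by
    calc 14 * Real.log N * B * ℓ ^ 2 * W ≤ 14 * ℓ * B * ℓ ^ 2 * W := by gcongr
      _ = 14 * ℓ ^ 3 * (B * W) := by ring
  have F4 : (r : ℝ) ^ 2 * ℓ ≤ r ^ 2 * ℓ ^ 3 := by gcongr
  have F5 : 0 ≤ (r : ℝ) ^ 2 * ℓ ^ 3 := by positivity
  rw [vonMangoldt_eq_vaughan s s, expSum_add, expSum_sub, expSum_add]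
  refine (norm_add_le _ _).trans ?_
  have G1 := norm_sub_le (expSum α N (vonMangoldt.truncate s)
    + expSum α N ((moebius : ArithmeticFunction ℝ).truncate s * log))
    (expSum α N ((moebius : ArithmeticFunction ℝ).truncate s * vonMangoldt.truncate s
      * (zeta : ArithmeticFunction ℝ)))
  have G2 := norm_add_le (expSum α N (vonMangoldt.truncate s))
    (expSum α N ((moebius : ArithmeticFunction ℝ).truncate s * log))
  linarith

/-- A form of Vinogradov's estimate for exponential sums over primes. -/
theorem exists_norm_expSum_vonMangoldt_le_rpow {δ : ℝ} (hδ : 0 < δ) :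
    ∃ C : ℝ, 0 < C ∧ ∀ (α : ℝ) (c : ℤ) (r N : ℕ), 2 ≤ r → IsCoprime c (r : ℤ) →
      |α - c / r| ≤ 1 / (r : ℝ) ^ 2 → r ^ 2 ≤ N →
      ‖expSum α N ArithmeticFunction.vonMangoldt‖ ≤
        C * (N : ℝ) ^ δ * (r ^ 2 + N * (r : ℝ) ^ (-(1 / 4) : ℝ)) := by
  obtain ⟨D, hD1, hD⟩ := exists_card_divisors_le_rpow (half_pos hδ)
  set K : ℝ := 1 + 1 / (δ / 6) with hK
  have hK0 : 0 < K := by positivity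
  refine ⟨14 * K ^ 3 * (D * 2 ^ (δ / 2)), by positivity, fun α c r N hr hcr hα hrN => ?_⟩
  have hN1 : 1 ≤ N := le_trans (by nlinarith) hrN
  have hN1' : (1 : ℝ) ≤ N := by exact_mod_cast hN1
  have hN0 : (0 : ℝ) < N := by linarith
  have h := norm_expSum_vonMangoldt_le hr hcr hα N hrN (D * (2 * N) ^ (δ / 2)) (by
    intro n hn hnN
    refine (hD n hn).trans ?_
    gcongr
    exact_mod_cast hnN)
  have hlog0 : 0 ≤ 1 + Real.log N := by have := Real.log_natCast_nonneg N; linarith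
  have hlog : 1 + Real.log N ≤ K * (N : ℝ) ^ (δ / 6) := by
    have h1 := Real.log_le_rpow_div hN0.le (by positivity : 0 < δ / 6)
    have h2 : (1 : ℝ) ≤ (N : ℝ) ^ (δ / 6) := Real.one_le_rpow hN1' (by positivity)
    calc 1 + Real.log N ≤ (N : ℝ) ^ (δ / 6) + (N : ℝ) ^ (δ / 6) / (δ / 6) := add_le_add h2 h1
      _ = K * (N : ℝ) ^ (δ / 6) := by rw [hK]; ring
  have hlog3 : (1 + Real.log N) ^ 3 ≤ K ^ 3 * (N : ℝ) ^ (δ / 2) := by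
    calc (1 + Real.log N) ^ 3 ≤ (K * (N : ℝ) ^ (δ / 6)) ^ 3 := by gcongr
      _ = K ^ 3 * (N : ℝ) ^ (δ / 2) := by
        rw [mul_pow, ← Real.rpow_natCast ((N : ℝ) ^ (δ / 6)), ← Real.rpow_mul hN0.le]
        congr 2
        push_cast
        ring
  set W : ℝ := N * (r : ℝ) ^ (-(1 / 4) : ℝ) with hW
  have hW0 : 0 ≤ W := by positivity
  have hE : 1 ≤ D * (2 * N : ℝ) ^ (δ / 2) :=
    one_le_mul_of_one_le_of_one_le hD1 (Real.one_le_rpow (by linarith) (by positivity))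
  calc _ ≤ _ := h
    _ ≤ 14 * (1 + Real.log N) ^ 3 *
        (D * (2 * N) ^ (δ / 2) * r ^ 2 + D * (2 * N) ^ (δ / 2) * W) := by
        gcongr
        exact le_mul_of_one_le_left (by positivity) hE
    _ = 14 * (1 + Real.log N) ^ 3 * (D * (2 * N) ^ (δ / 2)) * (r ^ 2 + W) := by ring
    _ ≤ 14 * (K ^ 3 * (N : ℝ) ^ (δ / 2)) * (D * (2 * N) ^ (δ / 2)) * (r ^ 2 + W) := by gcongr
    _ = 14 * K ^ 3 * (D * 2 ^ (δ / 2)) * ((N : ℝ) ^ (δ / 2) * (N : ℝ) ^ (δ / 2)) *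
        (r ^ 2 + W) := by
        rw [Real.mul_rpow (by norm_num) hN0.le]
        ring
    _ = _ := by rw [← Real.rpow_add hN0, add_halves]

/-! ### The type of an irrational number -/

theorem distNearestInt_mul_natCast_pos {γ : ℝ} (hγ : Irrational γ) {n : ℕ} (hn : n ≠ 0) :
    0 < distNearestInt (γ * n) := by
  refine abs_pos.2 (sub_ne_zero.2 ?_)
  exact (hγ.mul_natCast hn).ne_int _

theorem exists_pos_forall_lt_le (f : ℕ → ℝ) (hf : ∀ n, n ≠ 0 → 0 < f n) (n₀ : ℕ) :
    ∃ c : ℝ, 0 < c ∧ ∀ n, n ≠ 0 → n < n₀ → c ≤ f n := by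
  induction n₀ with
  | zero => exact ⟨1, one_pos, fun n _ h => absurd h (Nat.not_lt_zero n)⟩
  | succ k ih =>
    obtain ⟨c, hc, h⟩ := ih
    rcases eq_or_ne k 0 with rfl | hk
    · exact ⟨1, one_pos, fun n h0 h1 => by omega⟩
    · refine ⟨min c (f k), lt_min hc (hf k hk), fun n h0 h1 => ?_⟩
      rcases Nat.lt_succ_iff_lt_or_eq.1 h1 with h2 | rfl
      · exact (min_le_left _ _).trans (h n h0 h2)
      · exact min_le_right _ _

/-- The limit inferior controls only the large `n`; irrationality takes care of the others. -/
theorem exists_forall_le_rpow_mul_distNearestInt {γ : ℝ} (hγ : Irrational γ) {ρ : ℝ}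
    (hρ : diophantineType γ < (ρ : EReal)) :
    ∃ c : ℝ, 0 < c ∧ ∀ n : ℕ, n ≠ 0 → c ≤ (n : ℝ) ^ ρ * distNearestInt (γ * n) := by
  have hne : Filter.liminf
      (fun n : ℕ => ENNReal.ofReal ((n : ℝ) ^ ρ * distNearestInt (γ * n))) Filter.atTop ≠ 0 := by
    intro h
    exact absurd hρ (not_lt.2 (le_sSup ⟨ρ, h, rfl⟩))
  obtain ⟨c', hc0, hc'⟩ := exists_between (pos_iff_ne_zero.2 hne)
  obtain ⟨n₀, hn₀⟩ := Filter.eventually_atTop.1 (Filter.eventually_lt_of_lt_liminf hc')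
  have hctop : c' ≠ ⊤ := ne_top_of_lt hc'
  obtain ⟨c, hc, h⟩ := exists_pos_forall_lt_le
    (fun n : ℕ => (n : ℝ) ^ ρ * distNearestInt (γ * n))
    (fun n hn => mul_pos (Real.rpow_pos_of_pos (by exact_mod_cast Nat.pos_of_ne_zero hn) _)
      (distNearestInt_mul_natCast_pos hγ hn)) n₀
  refine ⟨min c c'.toReal, lt_min hc (ENNReal.toReal_pos hc0.ne' hctop), fun n hn => ?_⟩
  rcases lt_or_ge n n₀ with hlt | hge
  · exact (min_le_left _ _).trans (h n hn hlt)
  · refine (min_le_right _ _).trans ?_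
    exact ((ENNReal.lt_ofReal_iff_toReal_lt hctop).1 (hn₀ n hge)).le

/-- By Dirichlet's theorem there are arbitrarily large `n` with `‖γ n‖` at most about `1 / n`. -/
theorem one_le_diophantineType {γ : ℝ} (hγ : Irrational γ) : 1 ≤ diophantineType γ := by
  have hmem : ∀ ρ : ℝ, 0 < ρ → ρ < 1 → (ρ : EReal) ≤ diophantineType γ := by
    intro ρ hρ0 hρ1
    refine le_sSup ⟨ρ, ?_, rfl⟩
    change Filter.liminf _ _ = 0
    refine le_antisymm (ENNReal.le_of_forall_pos_le_add fun η hη _ => ?_) zero_le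
    rw [zero_add]
    refine Filter.liminf_le_of_frequently_le' (Filter.frequently_atTop.2 fun n₀ => ?_)
    -- Dirichlet's denominator `k` exceeds `n₀` as soon as the quality of the approximation is below
    -- the minimum of `‖γ n‖` over `n < n₀`.
    obtain ⟨c, hc, h⟩ := exists_pos_forall_lt_le (fun n : ℕ => distNearestInt (γ * n))
      (fun n hn => distNearestInt_mul_natCast_pos hγ hn) n₀
    have hlim : Filter.Tendsto (fun n : ℕ => (n : ℝ) ^ (-(1 - ρ))) Filter.atTop (nhds 0) :=
      (tendsto_rpow_neg_atTop (by linarith)).comp tendsto_natCast_atTop_atTop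
    have hlim2 : Filter.Tendsto (fun n : ℕ => 1 / ((n : ℝ) + 1)) Filter.atTop (nhds 0) :=
      tendsto_one_div_add_atTop_nhds_zero_nat
    obtain ⟨n, hn1, hn2, hn3⟩ := ((hlim.eventually_lt_const (show (0 : ℝ) < η from hη)).and
      ((hlim2.eventually_lt_const hc).and (Filter.eventually_gt_atTop 0))).exists
    obtain ⟨k, hk0, hkn, hk⟩ := Real.exists_nat_abs_mul_sub_round_le γ hn3
    have hk' : distNearestInt (γ * k) ≤ 1 / (n + 1) := by rwa [distNearestInt, mul_comm γ]
    refine ⟨k, ?_, ?_⟩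
    · by_contra hlt
      have := h k hk0.ne' (by omega)
      linarith
    · rw [ENNReal.ofReal_le_iff_le_toReal ENNReal.coe_ne_top, ENNReal.coe_toReal]
      have hn0 : (0 : ℝ) < n := by exact_mod_cast hn3
      calc (k : ℝ) ^ ρ * distNearestInt (γ * k) ≤ (n : ℝ) ^ ρ * (1 / (n : ℝ)) := by
            refine mul_le_mul ?_ (hk'.trans ?_) (distNearestInt_nonneg _) (by positivity)
            · gcongr
            · gcongr
              linarith
        _ = (n : ℝ) ^ (-(1 - ρ)) := by
            rw [one_div, ← Real.rpow_neg_one, ← Real.rpow_add hn0]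
            ring_nf
        _ ≤ η := hn1.le
  refine le_of_forall_lt fun x hx => ?_
  obtain ⟨ρ, hρ, hρ1⟩ := EReal.lt_iff_exists_real_btwn.1 (max_lt hx zero_lt_one)
  rw [max_lt_iff] at hρ
  exact hρ.1.trans_le (hmem ρ (by exact_mod_cast hρ.2) (by exact_mod_cast hρ1))

/-! ### Detection of the progression by additive characters -/

theorem sum_range_addChar_div_eq {q i a : ℕ} (hi : i < q) (ha : a < q) :
    ∑ b ∈ Finset.range q, addChar (((i : ℝ) - a) / q * b) = if i = a then (q : ℂ) else 0 := by
  have hq : (q : ℝ) ≠ 0 := by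
    have : q ≠ 0 := by omega
    exact_mod_cast this
  split_ifs with h
  · simp [h, addChar_zero]
  · have h1 : (∑ b ∈ Finset.range q, addChar (((i : ℝ) - a) / q * b))
        * (addChar (((i : ℝ) - a) / q) - 1) = 0 := by
      simp_rw [addChar_mul_natCast]
      rw [geom_sum_mul, ← addChar_mul_natCast, div_mul_cancel₀ _ hq]
      have := addChar_intCast ((i : ℤ) - a)
      push_cast at this
      rw [this, sub_self]
    refine (mul_eq_zero.1 h1).resolve_right fun h2 => h ?_
    have h3 := four_mul_distNearestInt_le (((i : ℝ) - a) / q)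
    rw [h2, norm_zero] at h3
    have h4 : distNearestInt (((i : ℝ) - a) / q) = 0 :=
      le_antisymm (by linarith) (distNearestInt_nonneg _)
    have h5 := sub_eq_zero.1 (abs_eq_zero.1 h4)
    rw [div_eq_iff hq] at h5
    set z : ℤ := round (((i : ℝ) - a) / q)
    have h6 : (i : ℤ) - a = z * q := by exact_mod_cast h5
    have hz : z = 0 := by
      by_contra hz
      rcases lt_or_gt_of_ne hz with h | h
      · nlinarith
      · nlinarith
    rw [hz] at h6
    omega

/-- The sum over the progression `a` modulo `q` is an average of sums over all integers, with
frequencies `(x + b) / q`. -/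
theorem mul_sum_progression_eq (f : ℕ → ℂ) (x : ℝ) {q a : ℕ} (ha : a < q) (M : ℕ) :
    (q : ℂ) * ∑ m ∈ Finset.range M, f (q * m + a) * addChar (x * m)
      = ∑ b ∈ Finset.range q, addChar (-((x + b) / q * a)) *
          ∑ n ∈ Finset.range (q * M), f n * addChar ((x + b) / q * n) := by
  have hq : (q : ℝ) ≠ 0 := by
    have : q ≠ 0 := by omega
    exact_mod_cast this
  have hmul : ∀ (g : ℕ → ℂ) (M : ℕ), ∑ n ∈ Finset.range (q * M), g n
      = ∑ m ∈ Finset.range M, ∑ i ∈ Finset.range q, g (q * m + i) := by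
    intro g M
    induction M with
    | zero => simp
    | succ M ih => rw [Nat.mul_succ, Finset.sum_range_add, ih, Finset.sum_range_succ]
  have hchar : ∀ b m i : ℕ, addChar (-((x + b) / q * a)) * addChar ((x + b) / q * (q * m + i : ℕ))
      = addChar (x * m) * addChar (x * ((i - a) / q)) * addChar (((i : ℝ) - a) / q * b) := by
    intro b m i
    rw [← addChar_add, ← addChar_add, ← addChar_add, ← mul_one (addChar (_ + _ + _)),
      ← addChar_intCast (b * m), ← addChar_add]
    congr 1
    push_cast
    field_simp
    ring
  simp_rw [hmul, Finset.mul_sum]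
  rw [Finset.sum_comm]
  refine Finset.sum_congr rfl fun m _ => ?_
  rw [Finset.sum_comm]
  have hterm : ∀ i ∈ Finset.range q, ∑ b ∈ Finset.range q, addChar (-((x + b) / q * a)) *
      (f (q * m + i) * addChar ((x + b) / q * (q * m + i : ℕ)))
      = if i = a then f (q * m + i) * (addChar (x * m) * addChar (x * ((i - a) / q))) * q
        else 0 := by
    intro i hi
    rw [← mul_ite_zero, ← sum_range_addChar_div_eq (Finset.mem_range.1 hi) ha, Finset.mul_sum]
    refine Finset.sum_congr rfl fun b _ => ?_
    rw [mul_left_comm, hchar]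
    ring
  rw [Finset.sum_congr rfl hterm, Finset.sum_ite_eq', if_pos (Finset.mem_range.2 ha), sub_self,
    zero_div, mul_zero, addChar_zero]
  ring

/-! ### Primes in progressions twisted by `γ k m` -/

/-- A number of finite type forces the denominators of the good approximations to
`(γ k + b) / q` to be large. -/
theorem le_rpow_mul_of_abs_sub_le {γ ρ c₀ : ℝ}
    (hγ : ∀ n : ℕ, n ≠ 0 → c₀ ≤ (n : ℝ) ^ ρ * distNearestInt (γ * n)) {k q b Q : ℕ}
    (hk : k ≠ 0) (hq : q ≠ 0) {p : ℚ}
    (hp : |(γ * k + b) / q - p| ≤ 1 / ((Q + 1) * p.den)) :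
    c₀ ≤ ((k : ℝ) * p.den) ^ ρ * (q / (Q + 1)) := by
  have hq0 : (0 : ℝ) < q := by exact_mod_cast Nat.pos_of_ne_zero hq
  have hr0 : (0 : ℝ) < p.den := by exact_mod_cast p.den_pos
  have h1 := hγ (k * p.den) (mul_ne_zero hk p.den_ne_zero)
  push_cast at h1
  refine h1.trans (mul_le_mul_of_nonneg_left ?_ (by positivity))
  refine (distNearestInt_le_abs_sub _ (p.num * q - b * p.den)).trans ?_
  have h2 : γ * (k * p.den) - ((p.num * q - b * p.den : ℤ) : ℝ)
      = q * p.den * ((γ * k + b) / q - p) := by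
    conv_rhs => rw [Rat.cast_def p]
    push_cast
    field_simp
    ring
  rw [h2, abs_mul, abs_of_pos (by positivity)]
  calc q * p.den * |(γ * k + b) / q - p| ≤ q * p.den * (1 / ((Q + 1) * p.den)) := by gcongr
    _ = q / (Q + 1) := by field_simp

/-- Vinogradov's estimate at the frequencies `(γ k + b) / q`, whose rational approximations come
from Dirichlet's theorem with denominators up to `M ^ (4 / 9)`. -/
theorem exists_norm_expSum_div_le {γ : ℝ} (hγ : Irrational γ) {ρ : ℝ} (hρ0 : 0 < ρ)
    (hρ : diophantineType γ < (ρ : EReal)) {ε β δ : ℝ} (hβ : β = (4 / 9 - ε / 4) / ρ - ε)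
    (hβ0 : 0 < β) (hδ : 0 < δ) :
    ∃ C : ℝ, 0 < C ∧ ∀ᶠ M : ℝ in Filter.atTop, ∀ k q b N : ℕ, 1 ≤ k → (k : ℝ) ≤ M ^ ε →
      1 ≤ q → (q : ℝ) ≤ M ^ (ε / 4) → ⌊M⌋₊ ≤ N →
      ‖expSum ((γ * k + b) / q) N ArithmeticFunction.vonMangoldt‖ ≤
        C * (N : ℝ) ^ δ * (M ^ (8 / 9 : ℝ) + N * M ^ (-(β / 4))) := by
  obtain ⟨c₀, hc₀, hγ'⟩ := exists_forall_le_rpow_mul_distNearestInt hγ hρ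
  obtain ⟨C, hC, hvin⟩ := exists_norm_expSum_vonMangoldt_le_rpow hδ
  set c₁ : ℝ := c₀ ^ (1 / ρ) with hc₁
  have hc₁0 : 0 < c₁ := Real.rpow_pos_of_pos hc₀ _
  set E : ℝ := 1 + c₁ ^ (-(1 / 4) : ℝ) with hE
  have hE' : 0 < c₁ ^ (-(1 / 4) : ℝ) := Real.rpow_pos_of_pos hc₁0 _
  refine ⟨C * E, by positivity, ?_⟩
  filter_upwards [Filter.eventually_ge_atTop 1,
    (tendsto_rpow_atTop hβ0).eventually_gt_atTop (1 / c₁)] with M hM1 hMβ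
  intro k q b N hk hkM hq hqM hMN
  have hM0 : 0 < M := by linarith
  set Q : ℕ := ⌊M ^ (4 / 9 : ℝ)⌋₊ with hQ
  have hM49 : 1 ≤ M ^ (4 / 9 : ℝ) := Real.one_le_rpow hM1 (by norm_num)
  have hQ0 : 0 < Q := Nat.floor_pos.2 hM49
  have hQle : (Q : ℝ) ≤ M ^ (4 / 9 : ℝ) := Nat.floor_le (by positivity)
  have hQlt : M ^ (4 / 9 : ℝ) ≤ Q + 1 := (Nat.lt_floor_add_one _).le
  obtain ⟨p, hp, hpQ⟩ := Real.exists_rat_abs_sub_le_and_den_le ((γ * k + b) / q) hQ0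
  have hr0 : (0 : ℝ) < p.den := by exact_mod_cast p.den_pos
  have hk0 : (0 : ℝ) < k := by exact_mod_cast hk
  have hpQ' : (p.den : ℝ) ≤ Q := by exact_mod_cast hpQ
  have hlow := le_rpow_mul_of_abs_sub_le hγ' (by omega) (by omega) hp
  have hlow2 : c₀ * M ^ (4 / 9 - ε / 4) ≤ ((k : ℝ) * p.den) ^ ρ := by
    have h1 : (q : ℝ) / (Q + 1) ≤ M ^ (ε / 4) / M ^ (4 / 9 : ℝ) := by gcongr
    have h2 : M ^ (ε / 4) / M ^ (4 / 9 : ℝ) * M ^ (4 / 9 - ε / 4) = 1 := by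
      rw [← Real.rpow_sub hM0, ← Real.rpow_add hM0]
      ring_nf
      exact Real.rpow_zero M
    calc c₀ * M ^ (4 / 9 - ε / 4)
        ≤ ((k : ℝ) * p.den) ^ ρ * (M ^ (ε / 4) / M ^ (4 / 9 : ℝ)) * M ^ (4 / 9 - ε / 4) := by
          gcongr
          exact hlow.trans (by gcongr)
      _ = ((k : ℝ) * p.den) ^ ρ := by rw [mul_assoc, h2, mul_one]
  have hlow3 : c₁ * M ^ β ≤ p.den := by
    have h1 : c₁ * M ^ ((4 / 9 - ε / 4) / ρ) ≤ k * p.den := by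
      have h2 : (c₀ * M ^ (4 / 9 - ε / 4)) ^ (1 / ρ) ≤ (((k : ℝ) * p.den) ^ ρ) ^ (1 / ρ) := by
        gcongr
      rwa [Real.mul_rpow hc₀.le (by positivity), ← Real.rpow_mul hM0.le,
        ← Real.rpow_mul (by positivity), mul_one_div, mul_one_div_cancel hρ0.ne',
        Real.rpow_one] at h2
    have h3 : c₁ * M ^ ((4 / 9 - ε / 4) / ρ) ≤ M ^ ε * p.den :=
      h1.trans (by gcongr)
    rw [hβ, Real.rpow_sub hM0, mul_div_assoc', div_le_iff₀ (by positivity)]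
    linarith
  have hr2 : 2 ≤ p.den := by
    have h1 : (1 : ℝ) < p.den := by
      rw [div_lt_iff₀ hc₁0] at hMβ
      linarith
    exact_mod_cast h1
  have hr89 : (p.den : ℝ) ^ 2 ≤ M ^ (8 / 9 : ℝ) := by
    calc (p.den : ℝ) ^ 2 ≤ (M ^ (4 / 9 : ℝ)) ^ 2 := by
          gcongr
          exact hpQ'.trans hQle
      _ = M ^ (8 / 9 : ℝ) := by
          rw [← Real.rpow_natCast, ← Real.rpow_mul hM0.le]
          norm_num
  have hrN : p.den ^ 2 ≤ N := by
    refine le_trans (Nat.le_floor ?_) hMN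
    push_cast
    refine hr89.trans ?_
    conv_rhs => rw [← Real.rpow_one M]
    exact Real.rpow_le_rpow_of_exponent_le hM1 (by norm_num)
  have hcop : IsCoprime p.num (p.den : ℤ) := by
    rw [Int.isCoprime_iff_nat_coprime]
    simpa using p.reduced
  have happ : |(γ * k + b) / q - p.num / p.den| ≤ 1 / (p.den : ℝ) ^ 2 := by
    rw [← Rat.cast_def]
    refine hp.trans ?_
    gcongr
    nlinarith
  have hr4 : (p.den : ℝ) ^ (-(1 / 4) : ℝ) ≤ c₁ ^ (-(1 / 4) : ℝ) * M ^ (-(β / 4)) := by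
    calc (p.den : ℝ) ^ (-(1 / 4) : ℝ) ≤ (c₁ * M ^ β) ^ (-(1 / 4) : ℝ) :=
          Real.rpow_le_rpow_of_nonpos (by positivity) hlow3 (by norm_num)
      _ = c₁ ^ (-(1 / 4) : ℝ) * M ^ (-(β / 4)) := by
          rw [Real.mul_rpow hc₁0.le (by positivity), ← Real.rpow_mul hM0.le]
          ring_nf
  calc _ ≤ C * (N : ℝ) ^ δ * (p.den ^ 2 + N * (p.den : ℝ) ^ (-(1 / 4) : ℝ)) :=
        hvin _ p.num p.den N hr2 hcop happ hrN
    _ ≤ C * (N : ℝ) ^ δ * (E * M ^ (8 / 9 : ℝ) + E * (N * M ^ (-(β / 4)))) := by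
        have h1 : (p.den : ℝ) ^ 2 ≤ E * M ^ (8 / 9 : ℝ) :=
          hr89.trans (le_mul_of_one_le_left (by positivity) (by linarith))
        have h2 : N * (p.den : ℝ) ^ (-(1 / 4) : ℝ) ≤ E * (N * M ^ (-(β / 4))) := by
          calc N * (p.den : ℝ) ^ (-(1 / 4) : ℝ)
              ≤ N * (c₁ ^ (-(1 / 4) : ℝ) * M ^ (-(β / 4))) := by gcongr
            _ = c₁ ^ (-(1 / 4) : ℝ) * (N * M ^ (-(β / 4))) := by ring
            _ ≤ E * (N * M ^ (-(β / 4))) := by gcongr; linarith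
        gcongr
    _ = _ := by ring

/-- The index `q (M + 1) - 1` is the last one of the full residue blocks `q m, …, q m + q - 1` with
`m ≤ M`; it does not depend on `a`. -/
theorem norm_sum_progression_le (x B : ℝ) {q a : ℕ} (ha : a < q) (M : ℕ) (hM : 1 ≤ M)
    (hB : ∀ b : ℕ, ‖expSum ((x + b) / q) (q * (M + 1) - 1) ArithmeticFunction.vonMangoldt‖ ≤ B) :
    ‖∑ m ∈ Finset.Icc 1 M,
        (ArithmeticFunction.vonMangoldt (q * m + a) : ℂ) * addChar (x * m)‖
      ≤ B + Real.log q := by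
  have hq0 : 0 < q := by omega
  have hq : (0 : ℝ) < q := by exact_mod_cast hq0
  set S : ℂ := ∑ m ∈ Finset.range (M + 1),
    (ArithmeticFunction.vonMangoldt (q * m + a) : ℂ) * addChar (x * m) with hS
  have hexp : ∀ b : ℕ, ∑ n ∈ Finset.range (q * (M + 1)),
      (ArithmeticFunction.vonMangoldt n : ℂ) * addChar ((x + b) / q * n)
      = expSum ((x + b) / q) (q * (M + 1) - 1) ArithmeticFunction.vonMangoldt := by
    intro b
    have h1 : q * (M + 1) = (q * (M + 1) - 1) + 1 := by
      have : 0 < q * (M + 1) := by positivity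
      omega
    rw [h1, Finset.sum_range_succ', expSum, sum_Ioc_zero_eq_sum_range]
    simp
  have hSB : ‖S‖ ≤ B := by
    have h1 : ‖(q : ℂ) * S‖ ≤ q * B := by
      rw [hS, mul_sum_progression_eq (fun n => (ArithmeticFunction.vonMangoldt n : ℂ)) x ha]
      calc _ ≤ ∑ b ∈ Finset.range q, B := by
            refine (norm_sum_le _ _).trans (Finset.sum_le_sum fun b _ => ?_)
            rw [norm_mul, norm_addChar, one_mul, hexp]
            exact hB b
        _ = q * B := by simp
    rw [norm_mul, Complex.norm_natCast] at h1
    exact le_of_mul_le_mul_left h1 hq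
  have hsplit : ∑ m ∈ Finset.Icc 1 M,
      (ArithmeticFunction.vonMangoldt (q * m + a) : ℂ) * addChar (x * m)
      = S - (ArithmeticFunction.vonMangoldt a : ℂ) := by
    rw [hS, Finset.sum_range_succ', show Finset.Icc 1 M = Finset.Ioc 0 M from rfl,
      sum_Ioc_zero_eq_sum_range]
    simp [addChar_zero]
  have hΛ : ‖(ArithmeticFunction.vonMangoldt a : ℂ)‖ ≤ Real.log q := by
    rw [Complex.norm_real, Real.norm_eq_abs,
      abs_of_nonneg ArithmeticFunction.vonMangoldt_nonneg]
    refine ArithmeticFunction.vonMangoldt_le_log.trans ?_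
    rcases Nat.eq_zero_or_pos a with rfl | ha0
    · simpa using Real.log_natCast_nonneg q
    · exact Real.log_le_log (by exact_mod_cast ha0) (by exact_mod_cast ha.le)
  rw [hsplit]
  exact (norm_sub_le _ _).trans (add_le_add hSB hΛ)

theorem mainTheorem3 (γ : ℝ) (hγ : Irrational γ) (τ : ℝ) (hτ : diophantineType γ = (τ : EReal))
    (ε : ℝ) (hε : 0 < ε) (hετ : ε < 1 / (8 * τ)) :
    ∃ η : ℝ, 0 < η ∧ ∃ M₀ : ℝ, ∀ M : ℝ, M₀ ≤ M →
      ∀ k a q : ℕ, 1 ≤ k → (k : ℝ) ≤ M ^ ε →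
        a < q → (q : ℝ) ≤ M ^ (ε / 4) → Nat.Coprime a q →
        ‖∑ m ∈ Finset.Icc 1 ⌊M⌋₊,
            (ArithmeticFunction.vonMangoldt (q * m + a) : ℂ) * addChar (γ * k * m)‖
          ≤ M ^ (1 - η) := by
  have hτ1 : 1 ≤ τ := by
    have := one_le_diophantineType hγ
    rw [hτ] at this
    exact_mod_cast this
  rw [lt_div_iff₀ (by positivity)] at hετ
  have hε8 : ε < 1 / 8 := by nlinarith
  -- Any exponent above the type will do as long as `2 ε ρ + ε / 4 < 4 / 9`.
  set ρ : ℝ := 3 / 2 * τ with hρ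
  have hρ0 : 0 < ρ := by positivity
  have hρτ : diophantineType γ < (ρ : EReal) := by
    rw [hτ]
    exact_mod_cast (by linarith : τ < ρ)
  set β : ℝ := (4 / 9 - ε / 4) / ρ - ε with hβ
  have hβε : ε < β := by
    have : 2 * ε < (4 / 9 - ε / 4) / ρ := by
      rw [lt_div_iff₀ hρ0]
      nlinarith
    linarith
  -- Relative to `M`, the two terms of the estimate save `M ^ (1 / 9)` and `M ^ ((β - ε) / 4)`; a part
  -- `M ^ (κ / 2)` of this is spent on `N ^ (κ / 4)` and another `M ^ (κ / 4)` on the constants.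
  set κ : ℝ := min ((β - ε) / 4) (1 / 9) with hκ
  have hκ0 : 0 < κ := lt_min (by linarith) (by norm_num)
  have hκ1 : κ ≤ (β - ε) / 4 := min_le_left _ _
  have hκ2 : κ ≤ 1 / 9 := min_le_right _ _
  have hδ : 0 < κ / 4 := by positivity
  obtain ⟨C, hC, hev⟩ := exists_norm_expSum_div_le hγ hρ0 hρτ hβ (hε.trans hβε) hδ
  refine ⟨κ / 4, hδ, ?_⟩
  rw [← Filter.eventually_atTop]
  filter_upwards [hev, Filter.eventually_ge_atTop 1,
    (tendsto_rpow_atTop hδ).eventually_ge_atTop (3 * C * 2 ^ (κ / 4) + 2)] with M hM hM1 hMC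
  intro k a q hk hkM haq hqM _
  have hM0 : 0 < M := by linarith
  have hq0 : 0 < q := by omega
  have hfl : 1 ≤ ⌊M⌋₊ := Nat.floor_pos.2 hM1
  set N : ℕ := q * (⌊M⌋₊ + 1) - 1 with hN
  have hMN : ⌊M⌋₊ ≤ N := by
    have : 1 * (⌊M⌋₊ + 1) ≤ q * (⌊M⌋₊ + 1) := Nat.mul_le_mul_right _ hq0
    omega
  have hNM : (N : ℝ) ≤ 2 * M ^ (1 + ε / 4) := by
    calc (N : ℝ) ≤ ((q * (⌊M⌋₊ + 1) : ℕ) : ℝ) := by exact_mod_cast Nat.sub_le _ _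
      _ = q * (⌊M⌋₊ + 1) := by push_cast; ring
      _ ≤ M ^ (ε / 4) * (M + M) := by
          gcongr
          exact Nat.floor_le hM0.le
      _ = 2 * M ^ (1 + ε / 4) := by
          rw [Real.rpow_add hM0, Real.rpow_one]
          ring
  have hmono : ∀ {u v : ℝ}, u ≤ v → M ^ u ≤ M ^ v := fun h =>
    Real.rpow_le_rpow_of_exponent_le hM1 h
  have hNδ : (N : ℝ) ^ (κ / 4) ≤ 2 ^ (κ / 4) * M ^ (κ / 2) := by
    calc (N : ℝ) ^ (κ / 4) ≤ (2 * M ^ (1 + ε / 4)) ^ (κ / 4) := by gcongr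
      _ = 2 ^ (κ / 4) * M ^ ((1 + ε / 4) * (κ / 4)) := by
          rw [Real.mul_rpow (by norm_num) (by positivity), ← Real.rpow_mul hM0.le]
      _ ≤ 2 ^ (κ / 4) * M ^ (κ / 2) := by
          gcongr ?_ * ?_
          exact hmono (by nlinarith)
  set Y : ℝ := M ^ (1 - κ / 2) with hY
  have hY0 : 0 < Y := by positivity
  have hbound : C * (N : ℝ) ^ (κ / 4) * (M ^ (8 / 9 : ℝ) + N * M ^ (-(β / 4)))
      ≤ 3 * C * 2 ^ (κ / 4) * Y := by
    have h1 : M ^ (κ / 2) * M ^ (8 / 9 : ℝ) ≤ Y := by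
      rw [← Real.rpow_add hM0]
      exact hmono (by linarith)
    have h2 : M ^ (κ / 2) * (M ^ (1 + ε / 4) * M ^ (-(β / 4))) ≤ Y := by
      rw [← Real.rpow_add hM0, ← Real.rpow_add hM0]
      exact hmono (by linarith)
    calc C * (N : ℝ) ^ (κ / 4) * (M ^ (8 / 9 : ℝ) + N * M ^ (-(β / 4)))
        ≤ C * (2 ^ (κ / 4) * M ^ (κ / 2)) *
          (M ^ (8 / 9 : ℝ) + 2 * M ^ (1 + ε / 4) * M ^ (-(β / 4))) := by gcongr
      _ = C * 2 ^ (κ / 4) * (M ^ (κ / 2) * M ^ (8 / 9 : ℝ)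
          + 2 * (M ^ (κ / 2) * (M ^ (1 + ε / 4) * M ^ (-(β / 4))))) := by ring
      _ ≤ C * 2 ^ (κ / 4) * (Y + 2 * Y) := by gcongr
      _ = 3 * C * 2 ^ (κ / 4) * Y := by ring
  have hlog : Real.log q ≤ 2 * Y := by
    have h1 : (q : ℝ) ≤ M := by
      refine hqM.trans ?_
      conv_rhs => rw [← Real.rpow_one M]
      exact hmono (by linarith)
    have h2 : M ^ (1 / 2 : ℝ) ≤ Y := hmono (by linarith)
    calc Real.log q ≤ Real.log M := Real.log_le_log (by exact_mod_cast hq0) h1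
      _ ≤ M ^ (1 / 2 : ℝ) / (1 / 2) := Real.log_le_rpow_div hM0.le (by norm_num)
      _ ≤ 2 * Y := by linarith
  have hsum := norm_sum_progression_le (γ * k) _ haq ⌊M⌋₊ hfl
    (fun b => (hM k q b N hk hkM hq0 hqM hMN).trans hbound)
  calc _ ≤ 3 * C * 2 ^ (κ / 4) * Y + Real.log q := hsum
    _ ≤ (3 * C * 2 ^ (κ / 4) + 2) * Y := by linarith
    _ ≤ M ^ (κ / 4) * Y := by gcongr
    _ = M ^ (1 - κ / 4) := by
        rw [hY, ← Real.rpow_add hM0]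
        ring_nf
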